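/- Let $\mathcal K$ be a field, $T$ the set of monomials of $\mathcal K[x_1,\dots,x_n]$, $<$ a monomial order that refines the total degree, and $\mathrm{HM}(p)$ the head monomial of $p\neq 0$. Let $f_1,\dots,f_m$ be nonzero homogeneous polynomials, and run Faugère's (original, incremental) F5 algorithm on $(f_1,\dots,f_m)$. It works with labeled polynomials $r$, i.e. polynomials carrying a signature $\mathcal S(r)=t\mathbf F_i$ with $t\in T$, $i=\mathrm{index}(r)$; signatures are ordered by $t\mathbf F_i\prec u\mathbf F_j$ iff $i>j$, or $i=j$ and $t<u$; and $\mathcal S(cs\,r)=s\,\mathcal S(r)$ for $c\in\mathcal K$, $s\in T$. All labeled polynomials are kept in a list $R=(r_1,r_2,\dots)$, in which $r_i=(\mathbf F_i,f_i)$ for $i\le m$ and to which every newly created S-polynomial is appended (with a corresponding rewriting rule). For $i=m-1,\dots,1$ the call of $\mathtt{AlgorithmF5}$ with index $i$ starts from $G_i=G_{i+1}\cup\{r_i\}$ (with $G_m=\{r_m\}$, $G_{m+1}=\emptyset$) and enlarges $G_i$, degree by degree, by the sets $Done$ of reduced S-polynomials returned by $\mathtt{Reduction}$; $\varphi_i$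 denotes the normal form with respect to $G_i$. Consider a moment of the run, during the call with $i=1$, at which $\mathtt{Reduction}$ is just about to add a labeled polynomial $g$ to $Done$ ($g$ has been taken from $ToDo$ with minimal signature, its normal form is nonzero, and $\mathtt{IsReducible}$ finds no reductor for it). Let $G_g=G_1\cup Done$ at that moment, and let $R$ be the list at that moment. For $s\in T$ and $r_k\in G_g$, * $s r_k$ *satisfies the F5 criterion* if $\varphi_{\mathrm{index}(r_k)+1}(s\mathbf t)\ne s\mathbf t$, where $\mathbf t$ is the monomial of $\mathcal S(r_k)=\mathbf t\,\mathbf F_{\mathrm{index}(r_k)}$; * $s r_k$ *satisfies the Rewritten criterion* if there is a position $j>k$ in $R$ with $\mathcal S(r_j)\mid s\,\mathcal S(r_k)$. A *$G_g$-representation* of a labeled polynomial $p$ is a finite, possibly empty, sum $p=\sum_k c_kt_k\cdot b_{i_k}$ with $0\neq c_k\in\mathcal K$, $t_k\in T$, $b_{i_k}\in G_g$ and pairwise distinct pairs $(t_k,b_{i_k})$, where $b_i$ is the element of $G_g$ at position $i$ of $R$; it is *signature-safe* if $t_k\mathcal S(b_{i_k})\preccurlyeq\mathcal S(p)$ for all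 $k$. **Theorem.** Let $h\in G_g$ and $m=ct$ with $c\in\mathcal K$, $t\in T$ be such that $\mathcal S(mh)=t\,\mathcal S(h)\prec\mathcal S(g)$. Then $mh$ has a signature-safe $G_g$-representation $mh=\sum_k m_k\cdot b_{i_k}$, $m_k=c_kt_k$, such that for every $k$: 1. $t_kb_{i_k}$ does not satisfy the F5 criterion; 2. $t_kb_{i_k}$ does not satisfy the Rewritten criterion; 3. $\mathrm{HM}(m_kb_{i_k})\le\mathrm{HM}(mh)$. -/

import Mathlib

open MvPolynomial
open scoped MonomialOrder

noncomputable section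

namespace F5

/-- The monomials of `K[x_1, …, x_n]`, written additively: `a ≤ b` is divisibility, `a + b` is the
product, `a ⊔ b` is the lcm and `b - a` is the quotient `b / a` when `a ∣ b`. -/
abbrev Mon (n : ℕ) : Type := Fin n →₀ ℕ

/-- A monomial order is graded if it compares total degrees first. -/
def Graded {n : ℕ} (ord : MonomialOrder (Fin n)) : Prop :=
  ∀ a b : Mon n, a.degree < b.degree → a ≺[ord] b

/-! ### Signatures and labeled polynomials -/

/-- A signature `mon · F_idx`. -/
@[ext] structure Sig (n : ℕ) where
  mon : Mon n
  idx : ℕ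

/-- The product `t · σ` of a monomial and a signature. -/
def Sig.mul {n : ℕ} (t : Mon n) (σ : Sig n) : Sig n := ⟨t + σ.mon, σ.idx⟩

/-- The order of signatures: `t F_i ≺ u F_j` iff `i > j`, or `i = j` and `t < u`. -/
def Sig.Lt {n : ℕ} (ord : MonomialOrder (Fin n)) (σ τ : Sig n) : Prop :=
  τ.idx < σ.idx ∨ (σ.idx = τ.idx ∧ σ.mon ≺[ord] τ.mon)

/-- The non-strict order of signatures. -/
def Sig.Le {n : ℕ} (ord : MonomialOrder (Fin n)) (σ τ : Sig n) : Prop :=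
  Sig.Lt ord σ τ ∨ σ = τ

/-- Divisibility of signatures. -/
def Sig.Dvd {n : ℕ} (σ τ : Sig n) : Prop := σ.idx = τ.idx ∧ σ.mon ≤ τ.mon

/-- A labeled polynomial: a polynomial together with a signature. -/
structure LabeledPoly (n : ℕ) (K : Type*) [Field K] where
  sig : Sig n
  poly : MvPolynomial (Fin n) K

/-! ### Normal forms -/

section NormalForm

variable {n : ℕ} {K : Type*} [Field K] (ord : MonomialOrder (Fin n))

/-- `q` arises from `p` by cancelling one term of `p` with a multiple of an element of `B`. -/
def ReducesTo (B : Set (MvPolynomial (Fin n) K)) (p q : MvPolynomial (Fin n) K) : Prop :=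
  ∃ b ∈ B, b ≠ 0 ∧ ∃ t ∈ p.support, ord.degree b ≤ t ∧
    q = p - monomial (t - ord.degree b) (p.coeff t / ord.leadingCoeff b) * b

/-- `q` is a normal form of `p` with respect to `B`: it is obtained from `p` by finitely many
reductions, and it cannot be reduced any further. -/
def IsNormalForm (B : Set (MvPolynomial (Fin n) K)) (p q : MvPolynomial (Fin n) K) : Prop :=
  Relation.ReflTransGen (ReducesTo ord B) p q ∧ ∀ q', ¬ ReducesTo ord B q q'

end NormalForm

/-! ### States of the F5 algorithm -/

/-- A critical pair `[t, u₁, r₁, u₂, r₂]`; labeled polynomials are given by their positions. -/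
structure CritPair (n : ℕ) where
  t : Mon n
  u₁ : Mon n
  r₁ : ℕ
  u₂ : Mon n
  r₂ : ℕ

/-- The places of the program between which a run of the algorithm moves: between two calls of
`AlgorithmF5`, at the head of its `while` loop, inside `Spol`, inside `Reduction`, and inside the
`for r ∈ R_d` loop. -/
inductive Place
  | between
  | loop
  | spol
  | reduction
  | update

/-- The values of the variables of the algorithm.
* `R 1, …, R N` is the list of labeled polynomials generated so far (`R 1, …, R m` are the input);
* `rule i` is the array `Rule[i]`, newest rule first; a rule is a monomial and a position;
* `i` is the index of the present (or, between two calls, of the last finished) call of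
  `AlgorithmF5`, and `G j` is the set `G_j` for `i ≤ j`;
* `P` is the set of critical pairs and `Pd` the part of `P_d` that `Spol` still has to treat;
* `toDo` is the list `F` built by `Spol`, which then is the set `ToDo` of `Reduction`;
* `done` is the set `Done` of `Reduction`, which is then returned as `R_d`. -/
structure State (n : ℕ) (K : Type*) [Field K] where
  place : Place
  R : ℕ → LabeledPoly n K
  N : ℕ
  rule : ℕ → List (Mon n × ℕ)
  i : ℕ
  G : ℕ → Set ℕ
  P : Set (CritPair n)
  Pd : Set (CritPair n)
  toDo : Set ℕ
  done : Set ℕ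

namespace State

variable {n : ℕ} {K : Type*} [Field K] (ord : MonomialOrder (Fin n)) (s : State n K)

/-- The polynomial at position `k`. -/
def poly (k : ℕ) : MvPolynomial (Fin n) K := (s.R k).poly

/-- The signature of the labeled polynomial at position `k`. -/
def sig (k : ℕ) : Sig n := (s.R k).sig

/-- The head monomial of the polynomial at position `k`. -/
def hm (k : ℕ) : Mon n := ord.degree (s.poly k)

/-- `q` is a value of `φ_k(p)`, the normal form with respect to `G_k`. -/
def IsPhi (k : ℕ) (p q : MvPolynomial (Fin n) K) : Prop :=
  IsNormalForm ord (s.poly '' s.G k) p q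

/-- `φ_k(t) = t` for a monomial `t`. -/
def PhiFixes (k : ℕ) (t : Mon n) : Prop :=
  s.IsPhi ord k (monomial t 1) (monomial t 1)

/-- Appends a labeled polynomial to `R`, together with its rule (`N := N + 1` and `AddRule`). -/
def push (r : LabeledPoly n K) : State n K :=
  { s with
    N := s.N + 1
    R := Function.update s.R (s.N + 1) r
    rule := Function.update s.rule r.sig.idx ((r.sig.mon, s.N + 1) :: s.rule r.sig.idx) }

/-- Replaces the polynomial at position `k` and keeps its signature. -/
def setPoly (k : ℕ) (p : MvPolynomial (Fin n) K) : State n K :=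
  { s with R := Function.update s.R k ⟨s.sig k, p⟩ }

/-- `Rewrite(u, r_k)`: the position of the newest rule that divides `u · S(r_k)`, or `k`. -/
def rewrite (u : Mon n) (k : ℕ) : ℕ :=
  match (s.rule (s.sig k).idx).find? (fun x => decide (x.1 ≤ u + (s.sig k).mon)) with
  | some x => x.2
  | none => k

/-- `Rewritten?(u, r_k)`. -/
def IsRewritten (u : Mon n) (k : ℕ) : Prop := s.rewrite u k ≠ k

/-- The S-pair of `r_a` and `r_b`, with `r_a` as first part. -/
def mkPair (a b : ℕ) : CritPair n where
  t := s.hm ord a ⊔ s.hm ord b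
  u₁ := (s.hm ord a ⊔ s.hm ord b) - s.hm ord a
  r₁ := a
  u₂ := (s.hm ord a ⊔ s.hm ord b) - s.hm ord b
  r₂ := b

/-- `CritPair(r_a, r_b, i, φ_{i+1})`: the S-pair, with the part of greater signature first, unless
it is discarded by one of the checks of the procedure. -/
def critPair (a b : ℕ) : Set (CritPair n) :=
  { p |
    ((¬ Sig.Lt ord (Sig.mul (s.mkPair ord a b).u₁ (s.sig a))
          (Sig.mul (s.mkPair ord a b).u₂ (s.sig b)) ∧ p = s.mkPair ord a b) ∨
      (Sig.Lt ord (Sig.mul (s.mkPair ord a b).u₁ (s.sig a))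
          (Sig.mul (s.mkPair ord a b).u₂ (s.sig b)) ∧ p = s.mkPair ord b a)) ∧
    (s.sig p.r₁).idx ≤ s.i ∧
    s.PhiFixes ord (s.i + 1) (p.u₁ + (s.sig p.r₁).mon) ∧
    ((s.sig p.r₂).idx = s.i → s.PhiFixes ord (s.i + 1) (p.u₂ + (s.sig p.r₂).mon)) }

/-- The S-polynomial `u₁ r₁ - u₂ r₂` of a pair, with head coefficients normalized to `1`. -/
def spoly (p : CritPair n) : MvPolynomial (Fin n) K :=
  monomial p.u₁ (ord.leadingCoeff (s.poly p.r₁))⁻¹ * s.poly p.r₁ -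
    monomial p.u₂ (ord.leadingCoeff (s.poly p.r₂))⁻¹ * s.poly p.r₂

/-- `r_k` passes the checks (a) - (d) of `IsReducible` as a reductor of the labeled polynomial
with signature `S(r_h)` and polynomial `q`. -/
def IsReductor (h : ℕ) (q : MvPolynomial (Fin n) K) (k : ℕ) : Prop :=
  s.hm ord k ≤ ord.degree q ∧
  s.PhiFixes ord (s.i + 1) (ord.degree q - s.hm ord k + (s.sig k).mon) ∧
  ¬ s.IsRewritten (ord.degree q - s.hm ord k) k ∧
  Sig.mul (ord.degree q - s.hm ord k) (s.sig k) ≠ s.sig h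

/-- The set `G_i ∪ Done`, as a set of positions. -/
def Gg : Set ℕ := s.G s.i ∪ s.done

/-- `Reduction` takes an element `h` of minimal signature from `ToDo` and computes `q = φ(h)`. -/
structure Takes (h : ℕ) (q : MvPolynomial (Fin n) K) : Prop where
  place : s.place = Place.reduction
  mem : h ∈ s.toDo
  min : ∀ k ∈ s.toDo, ¬ Sig.Lt ord (s.sig k) (s.sig h)
  nf : s.IsPhi ord (s.i + 1) (s.poly h) q

/-- The algorithm is in the state just before it adds `g` to `Done`: `Reduction` has taken `g`,
the normal form `q = φ(g)` is not zero, and `IsReducible` finds no reductor. -/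
structure AboutToAdd (g : ℕ) (q : MvPolynomial (Fin n) K) : Prop extends s.Takes ord g q where
  ne_zero : q ≠ 0
  irreducible : ∀ k ∈ s.Gg, ¬ s.IsReductor ord g q k

/-- The state in which the algorithm starts the first call of `AlgorithmF5`, on input
`f 1, …, f m`: the labeled polynomials are `r_j = (F_j, f_j)`, there are no rules, `N = m` and
`G_m = {r_m}`. -/
def init (f : ℕ → MvPolynomial (Fin n) K) (m : ℕ) : State n K where
  place := Place.between
  R := fun j => ⟨⟨0, j⟩, f j⟩
  N := m
  rule := fun _ => []
  i := m
  G := fun j => if j = m then {m} else ∅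
  P := ∅
  Pd := ∅
  toDo := ∅
  done := ∅

end State

/-- One step of the algorithm. Where the algorithm chooses an element of a set, every choice is
allowed. -/
inductive Step {n : ℕ} {K : Type*} [Field K] (ord : MonomialOrder (Fin n)) :
    State n K → State n K → Prop
  /-- The call of `AlgorithmF5` with index `j = i - 1`: `G_j := G_i ∪ {r_j}`, and `P` gets the
  critical pairs of `r_j` with the elements of `G_i`. -/
  | call (s s' : State n K) (j : ℕ) (hplace : s.place = Place.between) (hj : 1 ≤ j)
      (hi : s.i = j + 1)
      (hs' : s' = { s with i := j, G := Function.update s.G j (insert j (s.G s.i)) }) :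
      Step ord s
        { s' with
          place := Place.loop
          P := { p | ∃ r ∈ s.G s.i, p ∈ s'.critPair ord j r } }
  /-- `AlgorithmF5` returns when `P` is empty. -/
  | ret (s : State n K) (hplace : s.place = Place.loop) (hP : s.P = ∅) :
      Step ord s { s with place := Place.between }
  /-- The critical pairs of minimal degree are moved from `P` to `P_d`. -/
  | select (s : State n K) (d : ℕ) (hplace : s.place = Place.loop)
      (hd : ∃ p ∈ s.P, p.t.degree = d) (hmin : ∀ p ∈ s.P, d ≤ p.t.degree) :
      Step ord s
        { s with
          place := Place.spol
          Pd := { p | p ∈ s.P ∧ p.t.degree = d }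
          P := { p | p ∈ s.P ∧ p.t.degree ≠ d }
          toDo := ∅ }
  /-- `Spol` discards a critical pair with a rewritten part. -/
  | spolSkip (s : State n K) (p : CritPair n) (hplace : s.place = Place.spol) (hp : p ∈ s.Pd)
      (hrw : s.IsRewritten p.u₁ p.r₁ ∨ s.IsRewritten p.u₂ p.r₂) :
      Step ord s { s with Pd := s.Pd \ {p} }
  /-- `Spol` creates the S-polynomial of any other critical pair. -/
  | spolAdd (s : State n K) (p : CritPair n) (hplace : s.place = Place.spol) (hp : p ∈ s.Pd)
      (h₁ : ¬ s.IsRewritten p.u₁ p.r₁) (h₂ : ¬ s.IsRewritten p.u₂ p.r₂) :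
      Step ord s
        { s.push ⟨Sig.mul p.u₁ (s.sig p.r₁), s.spoly ord p⟩ with
          Pd := s.Pd \ {p}
          toDo := insert (s.N + 1) s.toDo }
  /-- `Spol` returns `F`, and `Reduction` starts. -/
  | startReduction (s : State n K) (hplace : s.place = Place.spol) (hPd : s.Pd = ∅) :
      Step ord s { s with place := Place.reduction, done := ∅ }
  /-- `TopReduction` drops a labeled polynomial whose normal form is zero. -/
  | zero (s : State n K) (h : ℕ) (hh : s.Takes ord h 0) :
      Step ord s { s.setPoly h 0 with toDo := s.toDo \ {h} }
  /-- A nonzero polynomial without reductor is made monic and added to `Done`. -/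
  | add (s : State n K) (g : ℕ) (q : MvPolynomial (Fin n) K) (hg : s.AboutToAdd ord g q) :
      Step ord s
        { s.setPoly g (C (ord.leadingCoeff q)⁻¹ * q) with
          toDo := s.toDo \ {g}
          done := insert g s.done }
  /-- `TopReduction` by a reductor of smaller signature. -/
  | reduce (s : State n K) (h : ℕ) (q : MvPolynomial (Fin n) K) (k : ℕ) (hh : s.Takes ord h q)
      (hq : q ≠ 0) (hk : k ∈ s.Gg) (hred : s.IsReductor ord h q k)
      (hlt : Sig.Lt ord (Sig.mul (ord.degree q - s.hm ord k) (s.sig k)) (s.sig h)) :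
      Step ord s
        (s.setPoly h (q -
          monomial (ord.degree q - s.hm ord k)
            (ord.leadingCoeff q / ord.leadingCoeff (s.poly k)) * s.poly k))
  /-- `TopReduction` by a reductor of greater signature creates a new labeled polynomial. -/
  | split (s : State n K) (h : ℕ) (q : MvPolynomial (Fin n) K) (k : ℕ) (hh : s.Takes ord h q)
      (hq : q ≠ 0) (hk : k ∈ s.Gg) (hred : s.IsReductor ord h q k)
      (hnlt : ¬ Sig.Lt ord (Sig.mul (ord.degree q - s.hm ord k) (s.sig k)) (s.sig h)) :
      Step ord s
        { (s.setPoly h q).push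
            ⟨Sig.mul (ord.degree q - s.hm ord k) (s.sig k),
              monomial (ord.degree q - s.hm ord k) (ord.leadingCoeff (s.poly k))⁻¹ * s.poly k -
                C (ord.leadingCoeff q)⁻¹ * q⟩ with
          toDo := insert (s.N + 1) s.toDo }
  /-- `Reduction` returns `R_d = Done` when `ToDo` is empty. -/
  | endReduction (s : State n K) (hplace : s.place = Place.reduction) (htoDo : s.toDo = ∅) :
      Step ord s { s with place := Place.update }
  /-- An element of `R_d` is moved to `G_i`, and its critical pairs with `G_i` are added to `P`. -/
  | move (s : State n K) (r : ℕ) (hplace : s.place = Place.update) (hr : r ∈ s.done) :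
      Step ord s
        { s with
          done := s.done \ {r}
          P := s.P ∪ { p | ∃ r' ∈ s.G s.i, p ∈ s.critPair ord r r' }
          G := Function.update s.G s.i (insert r (s.G s.i)) }
  /-- The next iteration of the `while` loop starts when all of `R_d` has been treated. -/
  | again (s : State n K) (hplace : s.place = Place.update) (hdone : s.done = ∅) :
      Step ord s { s with place := Place.loop }

/-- `s` occurs in a run of the algorithm on the input `f 1, …, f m`. -/
def Reachable {n : ℕ} {K : Type*} [Field K] (ord : MonomialOrder (Fin n))
    (f : ℕ → MvPolynomial (Fin n) K) (m : ℕ) (s : State n K) : Prop :=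
  Relation.ReflTransGen (Step ord) (State.init f m) s

/-! ### Criteria and representations -/

namespace State

variable {n : ℕ} {K : Type*} [Field K] (ord : MonomialOrder (Fin n)) (s : State n K)

/-- `t · r_k` satisfies the F5 criterion: `φ_{index + 1}` changes the monomial of its signature. -/
def SatisfiesF5 (t : Mon n) (k : ℕ) : Prop :=
  ¬ s.PhiFixes ord ((s.sig k).idx + 1) (Sig.mul t (s.sig k)).mon

/-- `t · r_k` satisfies the Rewritten criterion: its signature is divisible by the signature of a
labeled polynomial at a later position of `R`. -/
def SatisfiesRewritten (t : Mon n) (k : ℕ) : Prop :=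
  ∃ j, k < j ∧ j ≤ s.N ∧ Sig.Dvd (s.sig j) (Sig.mul t (s.sig k))

/-- `ρ` is a representation of `p` by `G_i ∪ Done`. It has the elements `c t · r_k`, where
`c = ρ (t, k) ≠ 0`; so all pairs `(t, k)` that occur are distinct. -/
def IsRepr (p : MvPolynomial (Fin n) K) (ρ : (Mon n × ℕ) →₀ K) : Prop :=
  (∀ x ∈ ρ.support, x.2 ∈ s.Gg) ∧ p = ρ.sum fun x c => monomial x.1 c * s.poly x.2

/-- The representation is signature-safe for a labeled polynomial of signature `σ`. -/
def SignatureSafe (σ : Sig n) (ρ : (Mon n × ℕ) →₀ K) : Prop :=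
  ∀ x ∈ ρ.support, Sig.Le ord (Sig.mul x.1 (s.sig x.2)) σ

end State

end F5

end

/-! Every labeled polynomial is the image of a module element whose head monomial is its signature
(`HasSig`). So it suffices to prove, by induction on σ ≺ S(g), a statement about signatures
(`Inv.exists_goodRepr`): every polynomial of the form c · `gen f σ` plus an element of `below ord f
m σ` has a representation as required, safe for σ.

If `gen f σ` itself lies below σ (σ is the head of a syzygy), a smaller signature does the job.
Otherwise take the last position k of `R` whose signature divides σ, say t S(r_k) = σ
(`Inv.exists_generator`). Being last, t r_k is not rewritten. The F5 criterion, or r_k = 0, would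
make σ the head of a syzygy. Since g has minimal signature in `toDo`, r_k is no longer there, so r_k
∈ G_g. Subtracting a multiple of t r_k leaves a remainder of smaller signature, which the induction
represents.

Only the bound on head monomials can fail. If HM(t r_k) > HM(p), the remainder has head monomial
HM(t r_k), so its representation contains a multiple with this same head monomial and a smaller
signature, and both multiples pass both criteria. `Inv.no_collision` rules this out. The S-pair of
the two elements passes the criteria too, and by homogeneity and the graded order its degree is at
most the degree d being treated. If one of the elements is in `done`, its cofactor is 1, and the
other is a reductor that `IsReducible` should have found. If both are in G_i, the pair must still be
waiting in `P`, where all degrees exceed d.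

These facts about a run are an invariant (`Inv`, `PlaceInv`), checked for every step. Neither
termination nor any Gröbner basis property of the G_j is used. -/

namespace F5

/-! ### The order of signatures -/

section Signatures

variable {n : ℕ} {ord : MonomialOrder (Fin n)} {σ τ υ : Sig n}

theorem Sig.mul_mul (s t : Mon n) (σ : Sig n) : Sig.mul s (Sig.mul t σ) = Sig.mul (s + t) σ := by
  simp [Sig.mul, add_assoc]

theorem Sig.zero_mul (σ : Sig n) : Sig.mul 0 σ = σ := by
  simp [Sig.mul]

theorem Sig.Lt.trans (h : Sig.Lt ord σ τ) (h' : Sig.Lt ord τ υ) : Sig.Lt ord σ υ := by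
  rcases h with h | ⟨h, h1⟩ <;> rcases h' with h' | ⟨h', h1'⟩
  · exact Or.inl (h'.trans h)
  · exact Or.inl (h' ▸ h)
  · exact Or.inl (h ▸ h')
  · exact Or.inr ⟨h.trans h', h1.trans h1'⟩

theorem Sig.Lt.irrefl (σ : Sig n) : ¬ Sig.Lt ord σ σ := by
  rintro (h | ⟨-, h⟩)
  · exact lt_irrefl _ h
  · exact lt_irrefl _ h

theorem Sig.Lt.ne (h : Sig.Lt ord σ τ) : σ ≠ τ := by
  rintro rfl
  exact Sig.Lt.irrefl _ h

theorem Sig.lt_or_eq_or_gt (ord : MonomialOrder (Fin n)) (σ τ : Sig n) :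
    Sig.Lt ord σ τ ∨ σ = τ ∨ Sig.Lt ord τ σ := by
  rcases lt_trichotomy σ.idx τ.idx with h | h | h
  · exact Or.inr (Or.inr (Or.inl h))
  · rcases lt_trichotomy (ord.toSyn σ.mon) (ord.toSyn τ.mon) with h1 | h1 | h1
    · exact Or.inl (Or.inr ⟨h, h1⟩)
    · exact Or.inr (Or.inl (Sig.ext (ord.toSyn.injective h1) h))
    · exact Or.inr (Or.inr (Or.inr ⟨h.symm, h1⟩))
  · exact Or.inl (Or.inl h)

theorem Sig.lt_of_not_lt (h : ¬ Sig.Lt ord σ τ) (hne : σ ≠ τ) : Sig.Lt ord τ σ := by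
  rcases Sig.lt_or_eq_or_gt ord σ τ with h1 | h1 | h1
  · exact absurd h1 h
  · exact absurd h1 hne
  · exact h1

theorem Sig.Le.trans_lt (h : Sig.Le ord σ τ) (h' : Sig.Lt ord τ υ) : Sig.Lt ord σ υ := by
  rcases h with h | rfl
  · exact h.trans h'
  · exact h'

theorem Sig.Lt.trans_le (h : Sig.Lt ord σ τ) (h' : Sig.Le ord τ υ) : Sig.Lt ord σ υ := by
  rcases h' with h' | rfl
  · exact h.trans h'
  · exact h

theorem Sig.Le.not_lt (h : Sig.Le ord σ τ) : ¬ Sig.Lt ord τ σ :=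
  fun h' => Sig.Lt.irrefl _ (h.trans_lt h')

theorem Sig.Lt.idx_le (h : Sig.Lt ord σ τ) : τ.idx ≤ σ.idx := by
  rcases h with h | ⟨h, -⟩
  · exact h.le
  · exact h.ge

theorem Sig.lt_mul_iff (t : Mon n) :
    Sig.Lt ord (Sig.mul t σ) (Sig.mul t τ) ↔ Sig.Lt ord σ τ := by
  simp [Sig.Lt, Sig.mul]

theorem Sig.le_mul_self (t : Mon n) (σ : Sig n) : Sig.Le ord σ (Sig.mul t σ) := by
  by_cases h : t = 0
  · subst h
    exact Or.inr (Sig.zero_mul σ).symm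
  · refine Or.inl (Or.inr ⟨rfl, ?_⟩)
    simp only [Sig.mul, map_add]
    exact lt_add_of_pos_left _ (ord.toSyn_lt_iff_ne_zero.2 (by simpa using h))

theorem Sig.Dvd.exists_mul (h : Sig.Dvd σ τ) : ∃ t, Sig.mul t σ = τ :=
  ⟨τ.mon - σ.mon, Sig.ext (tsub_add_cancel_of_le h.2) h.1⟩

theorem Sig.dvd_mul_self (t : Mon n) (σ : Sig n) : Sig.Dvd σ (Sig.mul t σ) :=
  ⟨rfl, le_add_self⟩

theorem Sig.Dvd.trans (h : Sig.Dvd σ τ) (h' : Sig.Dvd τ υ) : Sig.Dvd σ υ :=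
  ⟨h.1.trans h'.1, h.2.trans h'.2⟩

theorem Sig.dvd_mul_of_le {s t : Mon n} (h : s ≤ t) (σ : Sig n) :
    Sig.Dvd (Sig.mul s σ) (Sig.mul t σ) :=
  ⟨rfl, add_le_add_left h _⟩

theorem Sig.Dvd.le (h : Sig.Dvd σ τ) : Sig.Le ord σ τ := by
  obtain ⟨t, rfl⟩ := h.exists_mul
  exact Sig.le_mul_self t σ

/-- The one use of the graded order: bounds on signatures become bounds on degrees. -/
theorem Sig.Lt.degree_le (hord : Graded ord) (h : Sig.Lt ord σ τ) (hi : σ.idx = τ.idx) :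
    σ.mon.degree ≤ τ.mon.degree := by
  rcases h with h | ⟨-, h⟩
  · omega
  · by_contra hc
    exact lt_asymm h (hord _ _ (not_le.1 hc))

/-- A greater index means a smaller signature, so there are infinite descents unless the index is
bounded. With the bound, `m - idx` is the first component of a lexicographic measure. -/
theorem Sig.wellFounded_lt (ord : MonomialOrder (Fin n)) (m : ℕ) :
    WellFounded fun σ τ : Sig n => σ.idx ≤ m ∧ Sig.Lt ord σ τ := by
  have hwf := (Prod.lex (α := ℕ) (β := ord.syn) ⟨(· < ·), _root_.wellFounded_lt⟩
    ⟨(· < ·), _root_.wellFounded_lt⟩).wf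
  refine Subrelation.wf (r := InvImage _ fun σ : Sig n => (m - σ.idx, ord.toSyn σ.mon)) ?_
    (InvImage.wf _ hwf)
  rintro σ τ ⟨hm, h | ⟨h, h1⟩⟩
  · exact Prod.Lex.left _ _ (show m - σ.idx < m - τ.idx by omega)
  · change Prod.Lex _ _ (m - σ.idx, _) (m - τ.idx, _)
    rw [h]
    exact Prod.Lex.right _ h1

end Signatures

/-! ### Polynomials with a given signature -/

section HasSig

variable {n : ℕ} {K : Type*} [Field K] (ord : MonomialOrder (Fin n))
  (f : ℕ → MvPolynomial (Fin n) K) (m : ℕ)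

/-- The product `t · f_i` that belongs to the signature `t F_i`. -/
noncomputable def gen (σ : Sig n) : MvPolynomial (Fin n) K := monomial σ.mon 1 * f σ.idx

/-- The span of the products `t · f_i` of signature less than `σ`. -/
noncomputable def below (σ : Sig n) : Submodule K (MvPolynomial (Fin n) K) :=
  Submodule.span K (gen f '' {τ | τ.idx ≤ m ∧ Sig.Lt ord τ σ})

/-- The span of the products `t · f_j` with `j > i`. -/
noncomputable def beyond (i : ℕ) : Submodule K (MvPolynomial (Fin n) K) :=
  Submodule.span K (gen f '' {τ | τ.idx ≤ m ∧ i < τ.idx})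

/-- `p` is the image of a module element with head monomial `σ`. -/
def HasSig (p : MvPolynomial (Fin n) K) (σ : Sig n) : Prop :=
  ∃ c : K, c ≠ 0 ∧ p - c • gen f σ ∈ below ord f m σ

variable {ord f m} {σ τ : Sig n} {p q : MvPolynomial (Fin n) K} {i : ℕ}

theorem monomial_mul_gen (t : Mon n) (c : K) (σ : Sig n) :
    monomial t c * gen f σ = c • gen f (Sig.mul t σ) := by
  simp only [gen, Sig.mul, ← mul_assoc, monomial_mul, mul_one]
  rw [← smul_mul_assoc, smul_monomial, smul_eq_mul, mul_one]

theorem gen_mem_below (hm : τ.idx ≤ m) (h : Sig.Lt ord τ σ) : gen f τ ∈ below ord f m σ :=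
  Submodule.subset_span ⟨τ, ⟨hm, h⟩, rfl⟩

theorem below_mono (h : Sig.Le ord σ τ) : below ord f m σ ≤ below ord f m τ :=
  Submodule.span_mono (Set.image_mono fun _ hυ => ⟨hυ.1, hυ.2.trans_le h⟩)

theorem beyond_le_below (h : σ.idx ≤ i) : beyond f m i ≤ below ord f m σ :=
  Submodule.span_mono (Set.image_mono fun _ hυ => ⟨hυ.1, Or.inl (h.trans_lt hυ.2)⟩)

theorem below_le_beyond (h : i < σ.idx) : below ord f m σ ≤ beyond f m i :=
  Submodule.span_mono (Set.image_mono fun _ hυ => ⟨hυ.1, h.trans_le hυ.2.idx_le⟩)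

theorem monomial_mul_mem_below (t : Mon n) (c : K) (h : p ∈ below ord f m σ) :
    monomial t c * p ∈ below ord f m (Sig.mul t σ) := by
  induction h using Submodule.span_induction with
  | mem x hx =>
    obtain ⟨τ, ⟨hm, hτ⟩, rfl⟩ := hx
    rw [monomial_mul_gen]
    exact Submodule.smul_mem _ _ (gen_mem_below hm ((Sig.lt_mul_iff t).2 hτ))
  | zero => simp
  | add x y _ _ hx hy => rw [mul_add]; exact add_mem hx hy
  | smul a x _ hx => rw [mul_smul_comm]; exact Submodule.smul_mem _ _ hx

theorem monomial_mul_mem_beyond (t : Mon n) (c : K) (h : p ∈ beyond f m i) :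
    monomial t c * p ∈ beyond f m i := by
  induction h using Submodule.span_induction with
  | mem x hx =>
    obtain ⟨τ, hτ, rfl⟩ := hx
    rw [monomial_mul_gen]
    exact Submodule.smul_mem _ _ (Submodule.subset_span ⟨Sig.mul t τ, hτ, rfl⟩)
  | zero => simp
  | add x y _ _ hx hy => rw [mul_add]; exact add_mem hx hy
  | smul a x _ hx => rw [mul_smul_comm]; exact Submodule.smul_mem _ _ hx

theorem mul_mem_beyond (q : MvPolynomial (Fin n) K) (h : p ∈ beyond f m i) :
    q * p ∈ beyond f m i := by
  induction q using MvPolynomial.induction_on' with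
  | monomial t c => exact monomial_mul_mem_beyond t c h
  | add q r hq hr => rw [add_mul]; exact add_mem hq hr

theorem HasSig.mem_below (h : HasSig ord f m p σ) (hm : σ.idx ≤ m) (hlt : Sig.Lt ord σ τ) :
    p ∈ below ord f m τ := by
  obtain ⟨c, -, hc⟩ := h
  rw [← sub_add_cancel p (c • gen f σ)]
  exact add_mem (below_mono (Or.inl hlt) hc) (Submodule.smul_mem _ _ (gen_mem_below hm hlt))

theorem HasSig.mem_beyond (h : HasSig ord f m p σ) (hm : σ.idx ≤ m) (hi : i < σ.idx) :
    p ∈ beyond f m i := by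
  obtain ⟨c, -, hc⟩ := h
  rw [← sub_add_cancel p (c • gen f σ)]
  exact add_mem (below_le_beyond hi hc)
    (Submodule.smul_mem _ _ (Submodule.subset_span ⟨σ, ⟨hm, hi⟩, rfl⟩))

theorem HasSig.monomial_mul (h : HasSig ord f m p σ) (t : Mon n) {c : K} (hc : c ≠ 0) :
    HasSig ord f m (monomial t c * p) (Sig.mul t σ) := by
  obtain ⟨a, ha, hp⟩ := h
  refine ⟨a * c, mul_ne_zero ha hc, ?_⟩
  have := monomial_mul_mem_below t c hp
  rwa [mul_sub, mul_smul_comm, monomial_mul_gen, smul_smul] at this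

theorem HasSig.C_mul (h : HasSig ord f m p σ) {c : K} (hc : c ≠ 0) :
    HasSig ord f m (C c * p) σ := by
  have := h.monomial_mul 0 hc
  rwa [Sig.zero_mul] at this

theorem HasSig.sub_of_mem_below (h : HasSig ord f m p σ) (hq : q ∈ below ord f m σ) :
    HasSig ord f m (p - q) σ := by
  obtain ⟨a, ha, hp⟩ := h
  exact ⟨a, ha, by rw [sub_right_comm]; exact sub_mem hp hq⟩

theorem hasSig_of_mon_eq_zero (hm : σ.mon = 0) : HasSig ord f m (f σ.idx) σ := by
  refine ⟨1, one_ne_zero, ?_⟩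
  simp [gen, hm]

/-- A labeled polynomial that has become zero exhibits its signature as the head of a syzygy. -/
theorem gen_mem_below_of_hasSig_zero (h : HasSig ord f m 0 σ) : gen f σ ∈ below ord f m σ := by
  obtain ⟨c, hc, h⟩ := h
  rw [zero_sub, neg_mem_iff] at h
  exact (Submodule.smul_mem_iff _ hc).1 h

/-- The product b f_i lies in `beyond` because b does. Expanded along the terms of b, it is a
nonzero multiple of `gen f σ` plus products of smaller signature. -/
theorem gen_mem_below_of_mon_eq_degree {b : MvPolynomial (Fin n) K} (hm : σ.idx ≤ m)
    (hb : b ∈ beyond f m σ.idx) (hb0 : b ≠ 0) (hσ : σ.mon = ord.degree b) :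
    gen f σ ∈ below ord f m σ := by
  have hterm (d : Mon n) (c : K) : monomial d c * f σ.idx = c • gen f ⟨d, σ.idx⟩ := by
    rw [gen, ← smul_mul_assoc, smul_monomial, smul_eq_mul, mul_one]
  have h1 : b * f σ.idx ∈ below ord f m σ := by
    have h := beyond_le_below (ord := ord) (le_refl σ.idx) (mul_mem_beyond (f σ.idx) hb)
    rwa [mul_comm] at h
  have h2 : ∀ d ∈ b.support.erase (ord.degree b),
      monomial d (b.coeff d) * f σ.idx ∈ below ord f m σ := by
    intro d hd
    rw [hterm]
    refine Submodule.smul_mem _ _ (gen_mem_below hm (Or.inr ⟨rfl, ?_⟩))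
    rw [hσ]
    exact lt_of_le_of_ne (ord.le_degree (Finset.mem_of_mem_erase hd))
      fun h => Finset.ne_of_mem_erase hd (ord.toSyn.injective h)
  have h3 : b * f σ.idx = ∑ d ∈ b.support, monomial d (b.coeff d) * f σ.idx := by
    rw [← Finset.sum_mul, ← b.as_sum]
  rw [← Finset.add_sum_erase _ _ (ord.degree_mem_support hb0)] at h3
  rw [h3] at h1
  have h4 := (Submodule.add_mem_iff_left _ (Submodule.sum_mem _ h2)).1 h1
  rw [hterm, ← hσ] at h4
  exact (Submodule.smul_mem_iff _ (hσ ▸ ord.coeff_degree_ne_zero_iff.2 hb0)).1 h4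

/-- The head monomial of an element of `(f_{i+1}, …, f_m)` times `F_i` is the signature of a
principal syzygy. -/
theorem gen_mem_below_of_mem_beyond {b : MvPolynomial (Fin n) K} (hm : σ.idx ≤ m)
    (hb : b ∈ beyond f m σ.idx) (hb0 : b ≠ 0) (hdvd : ord.degree b ≤ σ.mon) :
    gen f σ ∈ below ord f m σ := by
  obtain ⟨τ, hτ, hi⟩ : ∃ τ : Sig n, τ.mon = ord.degree b ∧ τ.idx = σ.idx := ⟨⟨_, _⟩, rfl, rfl⟩
  obtain ⟨t, rfl⟩ : ∃ t, Sig.mul t τ = σ := Sig.Dvd.exists_mul ⟨hi, hτ ▸ hdvd⟩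
  have := monomial_mul_mem_below t 1 (gen_mem_below_of_mon_eq_degree (σ := τ) hm hb hb0 hτ)
  rwa [monomial_mul_gen, one_smul] at this

/-- Splits off the largest signature of a finite combination, which brings an element of `below`
into the form required by the induction hypothesis. The coefficient may be 0, so cancellation does
no harm. -/
theorem exists_sub_smul_gen_mem_below (h : p ∈ below ord f m σ) :
    p = 0 ∨ ∃ τ : Sig n, τ.idx ≤ m ∧ Sig.Lt ord τ σ ∧ ∃ c : K,
      p - c • gen f τ ∈ below ord f m τ := by
  induction h using Submodule.span_induction with
  | mem x hx =>
    obtain ⟨τ, ⟨hm, hτ⟩, rfl⟩ := hx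
    exact Or.inr ⟨τ, hm, hτ, 1, by simp⟩
  | zero => exact Or.inl rfl
  | add x y _ _ hx hy =>
    rcases hx with rfl | ⟨τ, hτ, hlt, c, hc⟩
    · simpa using hy
    rcases hy with rfl | ⟨υ, hυ, hlt', c', hc'⟩
    · exact Or.inr ⟨τ, hτ, hlt, c, by simpa using hc⟩
    rcases Sig.lt_or_eq_or_gt ord τ υ with h | rfl | h
    · refine Or.inr ⟨υ, hυ, hlt', c', ?_⟩
      have : x ∈ below ord f m υ := by
        rw [← sub_add_cancel x (c • gen f τ)]
        exact add_mem (below_mono (Or.inl h) hc) (Submodule.smul_mem _ _ (gen_mem_below hτ h))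
      rw [add_sub_assoc]
      exact add_mem this hc'
    · refine Or.inr ⟨τ, hτ, hlt, c + c', ?_⟩
      rw [add_smul, add_sub_add_comm]
      exact add_mem hc hc'
    · refine Or.inr ⟨τ, hτ, hlt, c, ?_⟩
      have : y ∈ below ord f m τ := by
        rw [← sub_add_cancel y (c' • gen f υ)]
        exact add_mem (below_mono (Or.inl h) hc') (Submodule.smul_mem _ _ (gen_mem_below hυ h))
      rw [add_sub_right_comm]
      exact add_mem hc this
  | smul a x _ hx =>
    rcases hx with rfl | ⟨τ, hτ, hlt, c, hc⟩
    · simp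
    · refine Or.inr ⟨τ, hτ, hlt, a * c, ?_⟩
      rw [mul_smul, ← smul_sub]
      exact Submodule.smul_mem _ _ hc

end HasSig

/-! ### Normal forms of homogeneous polynomials -/

section NormalForm

variable {n : ℕ} {K : Type*} [Field K] {ord : MonomialOrder (Fin n)}
  {B : Set (MvPolynomial (Fin n) K)} {p q b : MvPolynomial (Fin n) K}

theorem degree_degree_of_isHomogeneous {d : ℕ} (hp : p.IsHomogeneous d) (h0 : p ≠ 0) :
    (ord.degree p).degree = d := by
  by_contra h
  exact ord.coeff_degree_ne_zero_iff.2 h0 (hp.coeff_eq_zero h)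

theorem degree_monomial_mul (t : Mon n) {c : K} (hc : c ≠ 0) (h0 : p ≠ 0) :
    ord.degree (monomial t c * p) = t + ord.degree p := by
  classical
  rw [ord.degree_mul (by simpa using hc) h0, ord.degree_monomial, if_neg hc]

theorem ReducesTo.isHomogeneous {d : ℕ} (hB : ∀ b ∈ B, ∃ e, b.IsHomogeneous e)
    (hp : p.IsHomogeneous d) (h : ReducesTo ord B p q) : q.IsHomogeneous d := by
  obtain ⟨b, hb, hb0, t, ht, hle, rfl⟩ := h
  obtain ⟨e, he⟩ := hB b hb
  refine hp.sub ?_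
  have htd : t.degree = d := by
    by_contra h
    exact (mem_support_iff.1 ht) (hp.coeff_eq_zero h)
  have hsum := congrArg Finsupp.degree (tsub_add_cancel_of_le hle)
  rw [map_add, degree_degree_of_isHomogeneous he hb0, htd] at hsum
  rw [← hsum]
  exact (isHomogeneous_monomial _ rfl).mul he

theorem IsNormalForm.isHomogeneous {d : ℕ} (hB : ∀ b ∈ B, ∃ e, b.IsHomogeneous e)
    (hp : p.IsHomogeneous d) (h : IsNormalForm ord B p q) : q.IsHomogeneous d := by
  obtain ⟨h, -⟩ := h
  induction h with
  | refl => exact hp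
  | tail _ h ih => exact h.isHomogeneous hB ih

theorem IsNormalForm.sub_mem_beyond {f : ℕ → MvPolynomial (Fin n) K} {m i : ℕ}
    (hB : ∀ b ∈ B, b ∈ beyond f m i) (h : IsNormalForm ord B p q) : p - q ∈ beyond f m i := by
  obtain ⟨h, -⟩ := h
  induction h with
  | refl => simp
  | tail _ h ih =>
    obtain ⟨b, hb, hb0, t, ht, hle, rfl⟩ := h
    rw [← sub_add]
    exact add_mem ih (monomial_mul_mem_beyond _ _ (hB b hb))

theorem IsNormalForm.not_degree_le (h : IsNormalForm ord B p q) (hq : q ≠ 0) (hb : b ∈ B)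
    (hb0 : b ≠ 0) : ¬ ord.degree b ≤ ord.degree q := fun hle =>
  h.2 _ ⟨b, hb, hb0, _, ord.degree_mem_support hq, hle, rfl⟩

/-- Normal forms need not be unique, but an irreducible monomial has no other. The F5 criterion thus
becomes divisibility by head monomials, independent of any choice of reductions. -/
theorem isNormalForm_monomial_iff (t : Mon n) :
    IsNormalForm ord B (monomial t (1 : K)) (monomial t 1) ↔
      ∀ b ∈ B, b ≠ 0 → ¬ ord.degree b ≤ t := by
  have hsupp : (monomial t (1 : K)).support = {t} := by
    classical
    rw [support_monomial, if_neg one_ne_zero]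
  constructor
  · intro h b hb hb0 hle
    exact h.2 _ ⟨b, hb, hb0, t, by simp [hsupp], hle, rfl⟩
  · rintro h
    refine ⟨.refl, ?_⟩
    rintro q ⟨b, hb, hb0, u, hu, hle, -⟩
    rw [hsupp, Finset.mem_singleton] at hu
    exact h b hb hb0 (hu ▸ hle)

end NormalForm

/-! ### The state of the algorithm -/

namespace State

section Basic

variable {n : ℕ} {K : Type*} [Field K] {ord : MonomialOrder (Fin n)} {s : State n K}

theorem phiFixes_iff (k : ℕ) (t : Mon n) :
    s.PhiFixes ord k t ↔ ∀ b ∈ s.G k, s.poly b ≠ 0 → ¬ s.hm ord b ≤ t := by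
  rw [PhiFixes, IsPhi, isNormalForm_monomial_iff, Set.forall_mem_image]
  rfl

theorem PhiFixes.mono {k : ℕ} {t u : Mon n} (h : s.PhiFixes ord k u) (htu : t ≤ u) :
    s.PhiFixes ord k t := by
  rw [phiFixes_iff] at *
  exact fun b hb hb0 hle => h b hb hb0 (hle.trans htu)

theorem not_satisfiesF5_iff {t : Mon n} {k : ℕ} :
    ¬ s.SatisfiesF5 ord t k ↔ s.PhiFixes ord ((s.sig k).idx + 1) (t + (s.sig k).mon) :=
  not_not

theorem SatisfiesF5.mono {t u : Mon n} {k : ℕ} (h : s.SatisfiesF5 ord t k) (htu : t ≤ u) :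
    s.SatisfiesF5 ord u k :=
  fun h' => h (PhiFixes.mono h' (add_le_add_left htu _))

theorem SatisfiesRewritten.mono {t u : Mon n} {k : ℕ} (h : s.SatisfiesRewritten t k)
    (htu : t ≤ u) : s.SatisfiesRewritten u k := by
  obtain ⟨j, hkj, hj, hdvd⟩ := h
  exact ⟨j, hkj, hj, hdvd.trans (Sig.dvd_mul_of_le htu _)⟩

theorem mkPair_u₁_add (a b : ℕ) :
    (s.mkPair ord a b).u₁ + s.hm ord a = (s.mkPair ord a b).t :=
  tsub_add_cancel_of_le le_sup_left

theorem mkPair_u₂_add (a b : ℕ) :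
    (s.mkPair ord a b).u₂ + s.hm ord b = (s.mkPair ord a b).t :=
  tsub_add_cancel_of_le le_sup_right

theorem mkPair_u₁_comm (a b : ℕ) : (s.mkPair ord b a).u₁ = (s.mkPair ord a b).u₂ := by
  simp [mkPair, sup_comm]

theorem mkPair_u₂_comm (a b : ℕ) : (s.mkPair ord b a).u₂ = (s.mkPair ord a b).u₁ := by
  simp [mkPair, sup_comm]

theorem sig_setPoly (h : ℕ) (p : MvPolynomial (Fin n) K) (k : ℕ) :
    (s.setPoly h p).sig k = s.sig k := by
  by_cases hk : k = h
  · subst hk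
    simp [setPoly, sig]
  · simp [setPoly, sig, Function.update_of_ne hk]

theorem poly_setPoly_self (h : ℕ) (p : MvPolynomial (Fin n) K) :
    (s.setPoly h p).poly h = p := by
  simp [setPoly, poly]

theorem poly_setPoly_of_ne {h k : ℕ} (hk : k ≠ h) (p : MvPolynomial (Fin n) K) :
    (s.setPoly h p).poly k = s.poly k := by
  simp [setPoly, poly, Function.update_of_ne hk]

theorem sig_push_self (r : LabeledPoly n K) : (s.push r).sig (s.N + 1) = r.sig := by
  simp [push, sig]

theorem sig_push_of_le (r : LabeledPoly n K) {k : ℕ} (hk : k ≤ s.N) :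
    (s.push r).sig k = s.sig k := by
  simp [push, sig, Function.update_of_ne (show k ≠ s.N + 1 by omega)]

theorem poly_push_self (r : LabeledPoly n K) : (s.push r).poly (s.N + 1) = r.poly := by
  simp [push, poly]

theorem poly_push_of_le (r : LabeledPoly n K) {k : ℕ} (hk : k ≤ s.N) :
    (s.push r).poly k = s.poly k := by
  simp [push, poly, Function.update_of_ne (show k ≠ s.N + 1 by omega)]

/-- The condition under which the algorithm must not overlook the S-pair of `r_a` and `r_b`. -/
structure Needed (ord : MonomialOrder (Fin n)) (s : State n K) (a b : ℕ) : Prop where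
  lt : Sig.Lt ord (Sig.mul (s.mkPair ord a b).u₂ (s.sig b))
    (Sig.mul (s.mkPair ord a b).u₁ (s.sig a))
  f5₁ : ¬ s.SatisfiesF5 ord (s.mkPair ord a b).u₁ a
  f5₂ : ¬ s.SatisfiesF5 ord (s.mkPair ord a b).u₂ b
  rw₁ : ¬ s.SatisfiesRewritten (s.mkPair ord a b).u₁ a
  rw₂ : ¬ s.SatisfiesRewritten (s.mkPair ord a b).u₂ b

theorem not_needed_self (a : ℕ) : ¬ Needed ord s a a := fun h =>
  Sig.Lt.irrefl _ h.lt

/-- The strict inequality of signatures fixes the orientation, so `CritPair` returns the same pair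
whichever element it is given first. -/
theorem Needed.mem_critPair {a b : ℕ} (h : Needed ord s a b) (ha : (s.sig a).idx = s.i) :
    s.mkPair ord a b ∈ s.critPair ord a b ∧ s.mkPair ord a b ∈ s.critPair ord b a := by
  have h1 := not_satisfiesF5_iff.1 h.f5₁
  have h2 := not_satisfiesF5_iff.1 h.f5₂
  rw [ha] at h1
  have hrest : (s.sig a).idx ≤ s.i ∧
      s.PhiFixes ord (s.i + 1) ((s.mkPair ord a b).u₁ + (s.sig a).mon) ∧
      ((s.sig b).idx = s.i →
        s.PhiFixes ord (s.i + 1) ((s.mkPair ord a b).u₂ + (s.sig b).mon)) :=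
    ⟨ha.le, h1, fun hb => by rwa [hb] at h2⟩
  refine ⟨⟨Or.inl ⟨?_, rfl⟩, hrest⟩, ⟨Or.inr ⟨?_, rfl⟩, hrest⟩⟩
  · exact Sig.Le.not_lt (Or.inl h.lt)
  · rw [mkPair_u₁_comm, mkPair_u₂_comm a b]
    exact h.lt

/-- `p` is an S-pair of two elements of `G_i` with the part of greater signature first. -/
structure IsPair (ord : MonomialOrder (Fin n)) (s : State n K) (p : CritPair n) : Prop where
  eq : p = s.mkPair ord p.r₁ p.r₂
  mem₁ : p.r₁ ∈ s.G s.i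
  mem₂ : p.r₂ ∈ s.G s.i
  idx : (s.sig p.r₁).idx = s.i
  not_lt : ¬ Sig.Lt ord (Sig.mul p.u₁ (s.sig p.r₁)) (Sig.mul p.u₂ (s.sig p.r₂))
  ne : p.r₁ ≠ p.r₂

theorem isPair_of_mem_critPair {a b : ℕ} {p : CritPair n} (hp : p ∈ s.critPair ord a b)
    (hab : a ≠ b) (hai : s.i ≤ (s.sig a).idx) (hbi : s.i ≤ (s.sig b).idx) :
    p = s.mkPair ord p.r₁ p.r₂ ∧ (p.r₁ = a ∧ p.r₂ = b ∨ p.r₁ = b ∧ p.r₂ = a) ∧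
      (s.sig p.r₁).idx = s.i ∧
      ¬ Sig.Lt ord (Sig.mul p.u₁ (s.sig p.r₁)) (Sig.mul p.u₂ (s.sig p.r₂)) ∧ p.r₁ ≠ p.r₂ := by
  obtain ⟨⟨hlt, rfl⟩ | ⟨hlt, rfl⟩, hi, -⟩ := hp
  · exact ⟨rfl, Or.inl ⟨rfl, rfl⟩, le_antisymm hi hai, hlt, hab⟩
  · refine ⟨rfl, Or.inr ⟨rfl, rfl⟩, le_antisymm hi hbi, ?_, hab.symm⟩
    refine Sig.Le.not_lt (Or.inl ?_)
    rw [mkPair_u₁_comm, mkPair_u₂_comm]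
    exact hlt

/-- `S(t r_b) ≠ S(r_a)` whenever `r_b` is a top-reductor of `r_a ∈ Done` that passes the criteria
and was available when `r_a` was added to `Done`. -/
def DoneIrreducible (ord : MonomialOrder (Fin n)) (s : State n K) : Prop :=
  ∀ a ∈ s.done, (∀ b ∈ s.G (s.i + 1), ¬ s.hm ord b ≤ s.hm ord a) ∧
    ∀ b ∈ s.Gg, (b ∈ s.G s.i ∨ Sig.Lt ord (s.sig b) (s.sig a)) → (s.sig b).idx = s.i →
      s.hm ord b ≤ s.hm ord a → ¬ s.SatisfiesF5 ord (s.hm ord a - s.hm ord b) b →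
      ¬ s.SatisfiesRewritten (s.hm ord a - s.hm ord b) b →
      Sig.mul (s.hm ord a - s.hm ord b) (s.sig b) = s.sig a

/-- The degree `d` is being treated: `P_d`, `ToDo` and `Done` have degree `d`, and `P` has greater
degrees. `D j` is the degree of the input polynomial `f_j`. -/
structure HasDegree (D : ℕ → ℕ) (s : State n K) (d : ℕ) : Prop where
  P : ∀ p ∈ s.P, d < p.t.degree
  Pd : ∀ p ∈ s.Pd, p.t.degree = d
  toDo : ∀ k ∈ s.toDo, (s.sig k).mon.degree + D s.i = d
  done : ∀ k ∈ s.done, (s.sig k).mon.degree + D s.i = d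

/-- The part of the invariant that depends on the place of the program. -/
def PlaceInv (ord : MonomialOrder (Fin n)) (D : ℕ → ℕ) (s : State n K) : Prop :=
  match s.place with
  | .between => s.P = ∅ ∧ s.Pd = ∅ ∧ s.toDo = ∅ ∧ s.done = ∅
  | .loop => s.Pd = ∅ ∧ s.toDo = ∅ ∧ s.done = ∅
  | .spol => s.done = ∅ ∧ ∃ d, HasDegree D s d
  | .reduction => s.Pd = ∅ ∧ (∃ d, HasDegree D s d) ∧ DoneIrreducible ord s
  | .update => s.Pd = ∅ ∧ s.toDo = ∅

/-- The part of the invariant that does not depend on the place of the program. -/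
structure Inv (ord : MonomialOrder (Fin n)) (f : ℕ → MvPolynomial (Fin n) K) (m : ℕ) (D : ℕ → ℕ)
    (s : State n K) : Prop where
  one_le_i : 1 ≤ s.i
  i_le : s.i ≤ m
  m_le : m ≤ s.N
  sig_input : ∀ k ≤ m, s.sig k = ⟨0, k⟩
  poly_input : ∀ k ≤ m, s.poly k = f k
  idx_le : ∀ k ≤ s.N, (s.sig k).idx ≤ m
  le_idx : ∀ k, m < k → k ≤ s.N → s.i ≤ (s.sig k).idx
  mem_rule : ∀ j x, x ∈ s.rule j ↔ m < x.2 ∧ x.2 ≤ s.N ∧ s.sig x.2 = ⟨x.1, j⟩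
  rule_sorted : ∀ j, (s.rule j).Pairwise fun x y => y.2 < x.2
  hasSig : ∀ k, 1 ≤ k → k ≤ s.N → HasSig ord f m (s.poly k) (s.sig k)
  homog : ∀ k, 1 ≤ k → k ≤ s.N →
    (s.poly k).IsHomogeneous ((s.sig k).mon.degree + D (s.sig k).idx)
  G_eq : ∀ j, s.i ≤ j → s.G j = {k | k ∈ s.G s.i ∧ j ≤ (s.sig k).idx}
  G_mem : ∀ k ∈ s.G s.i, 1 ≤ k ∧ k ≤ s.N ∧ s.poly k ≠ 0
  toDo_mem : ∀ k ∈ s.toDo, m < k ∧ k ≤ s.N ∧ (s.sig k).idx = s.i ∧ k ∉ s.G s.i ∧ k ∉ s.done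
  done_mem : ∀ k ∈ s.done, m < k ∧ k ≤ s.N ∧ (s.sig k).idx = s.i ∧ k ∉ s.G s.i ∧ s.poly k ≠ 0
  covered : ∀ k, 1 ≤ k → k ≤ s.N → s.i ≤ (s.sig k).idx →
    k ∈ s.G s.i ∨ k ∈ s.done ∨ k ∈ s.toDo ∨ s.poly k = 0
  isPair : ∀ p ∈ s.P ∪ s.Pd, IsPair ord s p
  -- A pair that passes all criteria is still waiting. In particular, when a call has ended with no
  -- pairs left, G_i contains no needed pair at all.
  complete : ∀ a ∈ s.G s.i, ∀ b ∈ s.G s.i, Needed ord s a b →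
    (s.sig a).idx = s.i ∧ s.mkPair ord a b ∈ s.P ∪ s.Pd
  not_lt : ∀ a ∈ s.done, ∀ x ∈ s.toDo, ¬ Sig.Lt ord (s.sig x) (s.sig a)

end Basic

/-! ### The rewrite rules and the persistence of the criteria. -/

section Inv

variable {n : ℕ} {K : Type*} [Field K] {ord : MonomialOrder (Fin n)}
  {f : ℕ → MvPolynomial (Fin n) K} {m : ℕ} {D : ℕ → ℕ} {s : State n K}

theorem Inv.le_idx_of_mem_G (H : Inv ord f m D s) {j k : ℕ} (hj : s.i ≤ j) (hk : k ∈ s.G j) :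
    j ≤ (s.sig k).idx := by
  rw [H.G_eq j hj] at hk
  exact hk.2

theorem Inv.mem_G_i (H : Inv ord f m D s) {j k : ℕ} (hj : s.i ≤ j) (hk : k ∈ s.G j) :
    k ∈ s.G s.i := by
  rw [H.G_eq j hj] at hk
  exact hk.1

theorem Inv.Gg_mem (H : Inv ord f m D s) {k : ℕ} (hk : k ∈ s.Gg) :
    1 ≤ k ∧ k ≤ s.N ∧ s.i ≤ (s.sig k).idx ∧ s.poly k ≠ 0 := by
  rcases hk with hk | hk
  · obtain ⟨h1, h2, h3⟩ := H.G_mem k hk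
    exact ⟨h1, h2, H.le_idx_of_mem_G le_rfl hk, h3⟩
  · obtain ⟨h1, h2, h3, -, h4⟩ := H.done_mem k hk
    exact ⟨by omega, h2, h3.ge, h4⟩

/-- With the rules sorted newest first, the first hit has the latest position. -/
theorem le_of_find?_eq_some {α : Type*} {l : List (α × ℕ)} {P : α × ℕ → Bool}
    (hl : l.Pairwise fun x y => y.2 < x.2) {x : α × ℕ} (hx : l.find? P = some x) :
    ∀ y ∈ l, P y → y.2 ≤ x.2 := by
  induction l with
  | nil => simp
  | cons a l ih =>
    rw [List.pairwise_cons] at hl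
    intro y hy hPy
    by_cases hPa : P a
    · rw [List.find?_cons_of_pos hPa, Option.some.injEq] at hx
      subst hx
      rcases List.mem_cons.1 hy with rfl | hy
      · exact le_rfl
      · exact (hl.1 y hy).le
    · rw [List.find?_cons_of_neg hPa] at hx
      rcases List.mem_cons.1 hy with rfl | hy
      · exact absurd hPy hPa
      · exact ih hl.2 hx y hy hPy

/-- Input polynomials have no rules, but nothing is lost: their signatures have distinct indices, so
a later position whose signature divides u S(r_k) is beyond `m` and has a rule. Conversely, if k >
m, its own rule matches, so the newest match is at k or later. -/
theorem Inv.isRewritten_iff (H : Inv ord f m D s) {u : Mon n} {k : ℕ} (hk : k ≤ s.N) :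
    s.IsRewritten u k ↔ s.SatisfiesRewritten u k := by
  have hlater : ∀ j, k < j → j ≤ s.N → Sig.Dvd (s.sig j) (Sig.mul u (s.sig k)) →
      ((s.sig j).mon, j) ∈ s.rule (s.sig k).idx := by
    intro j hkj hj hdvd
    rw [H.mem_rule]
    refine ⟨?_, hj, Sig.ext rfl hdvd.1⟩
    by_contra hjm
    have h1 := hdvd.1
    rw [H.sig_input j (by omega), H.sig_input k (by omega)] at h1
    exact hkj.ne' h1
  rw [IsRewritten, rewrite]
  rcases hfind : (s.rule (s.sig k).idx).find? (fun x => decide (x.1 ≤ u + (s.sig k).mon)) with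
    _ | x
  · simp only [hfind, ne_eq, not_true_eq_false, false_iff]
    rintro ⟨j, hkj, hj, hdvd⟩
    have := List.find?_eq_none.1 hfind _ (hlater j hkj hj hdvd)
    exact this (decide_eq_true hdvd.2)
  · have hmax := le_of_find?_eq_some (H.rule_sorted _) hfind
    have hx := (H.mem_rule _ _).1 (List.mem_of_find?_eq_some hfind)
    have hle : x.1 ≤ u + (s.sig k).mon := by simpa using List.find?_some hfind
    simp only [hfind]
    constructor
    · intro hne
      refine ⟨x.2, ?_, hx.2.1, ?_⟩
      · by_cases hkm : k ≤ m
        · exact hkm.trans_lt hx.1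
        · refine lt_of_le_of_ne (hmax ((s.sig k).mon, k) ?_ ?_) hne.symm
          · rw [H.mem_rule]
            exact ⟨by omega, hk, rfl⟩
          · simp
      · rw [hx.2.2]
        exact ⟨rfl, hle⟩
    · rintro ⟨j, hkj, hj, hdvd⟩
      have := hmax _ (hlater j hkj hj hdvd) (decide_eq_true hdvd.2)
      exact (hkj.trans_le this).ne'

/-- `s'` has the same sets `G_j` and `Done` as `s`, with the same polynomials. -/
structure Frame (s s' : State n K) : Prop where
  i : s'.i = s.i
  G : s'.G = s.G
  done : s'.done = s.done
  N : s.N ≤ s'.N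
  sig : ∀ k ≤ s.N, s'.sig k = s.sig k
  poly : ∀ k ∈ s.Gg, s'.poly k = s.poly k

section Frame

variable {s' : State n K} (F : Frame s s')
include F

theorem Frame.hm {k : ℕ} (hk : k ∈ s.Gg) : s'.hm ord k = s.hm ord k := by
  rw [State.hm, F.poly k hk, State.hm]

theorem Frame.satisfiesF5_iff (H : Inv ord f m D s) {t : Mon n} {k : ℕ} (hk : k ∈ s.Gg) :
    s'.SatisfiesF5 ord t k ↔ s.SatisfiesF5 ord t k := by
  have hk' := H.Gg_mem hk
  rw [SatisfiesF5, SatisfiesF5, F.sig k hk'.2.1, phiFixes_iff, phiFixes_iff, F.G]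
  have : ∀ b ∈ s.G ((s.sig k).idx + 1), b ∈ s.Gg := fun b hb =>
    Or.inl (H.mem_G_i (by omega) hb)
  refine not_congr (forall₂_congr fun b hb => ?_)
  rw [F.poly b (this b hb), F.hm (this b hb)]

theorem Frame.satisfiesRewritten {t : Mon n} {k : ℕ} (hk : k ≤ s.N)
    (h : s.SatisfiesRewritten t k) : s'.SatisfiesRewritten t k := by
  obtain ⟨j, hkj, hj, hdvd⟩ := h
  exact ⟨j, hkj, hj.trans F.N, by rwa [F.sig j hj, F.sig k hk]⟩

theorem Frame.mkPair {a b : ℕ} (ha : a ∈ s.Gg) (hb : b ∈ s.Gg) :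
    s'.mkPair ord a b = s.mkPair ord a b := by
  simp only [State.mkPair, F.hm ha, F.hm hb]

/-- Head monomials and the F5 criterion are unchanged, while the list of signatures only grows. A
pair may become rewritten, but it never becomes needed. -/
theorem Frame.needed (H : Inv ord f m D s) {a b : ℕ} (ha : a ∈ s.Gg) (hb : b ∈ s.Gg)
    (h : Needed ord s' a b) : Needed ord s a b := by
  have ha' := (H.Gg_mem ha).2.1
  have hb' := (H.Gg_mem hb).2.1
  obtain ⟨h1, h2, h3, h4, h5⟩ := h
  rw [F.mkPair ha hb] at h1 h2 h3 h4 h5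
  rw [F.sig a ha', F.sig b hb'] at h1
  exact ⟨h1, mt (F.satisfiesF5_iff H ha).2 h2, mt (F.satisfiesF5_iff H hb).2 h3,
    mt (F.satisfiesRewritten ha') h4, mt (F.satisfiesRewritten hb') h5⟩

theorem Frame.isPair (H : Inv ord f m D s) {p : CritPair n} (h : IsPair ord s p) :
    IsPair ord s' p := by
  have h1 : p.r₁ ∈ s.Gg := Or.inl h.mem₁
  have h2 : p.r₂ ∈ s.Gg := Or.inl h.mem₂
  have h1' := (H.Gg_mem h1).2.1
  have h2' := (H.Gg_mem h2).2.1
  refine ⟨?_, ?_, ?_, ?_, ?_, h.ne⟩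
  · rw [F.mkPair h1 h2]
    exact h.eq
  · rw [F.G, F.i]
    exact h.mem₁
  · rw [F.G, F.i]
    exact h.mem₂
  · rw [F.sig _ h1', F.i]
    exact h.idx
  · rw [F.sig _ h1', F.sig _ h2']
    exact h.not_lt

theorem Frame.complete (H : Inv ord f m D s) (hP : s'.P = s.P) (hPd : s'.Pd = s.Pd) :
    ∀ a ∈ s'.G s'.i, ∀ b ∈ s'.G s'.i, Needed ord s' a b →
      (s'.sig a).idx = s'.i ∧ s'.mkPair ord a b ∈ s'.P ∪ s'.Pd := by
  intro a ha b hb hab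
  rw [F.G, F.i] at ha hb
  have ha' : a ∈ s.Gg := Or.inl ha
  have hb' : b ∈ s.Gg := Or.inl hb
  rw [F.sig a (H.Gg_mem ha').2.1, F.i, F.mkPair ha' hb', hP, hPd]
  exact H.complete a ha b hb (F.needed H ha' hb' hab)

theorem Frame.doneIrreducible (H : Inv ord f m D s) (h : DoneIrreducible ord s) :
    DoneIrreducible ord s' := by
  intro a ha
  rw [F.done] at ha
  have ha' : a ∈ s.Gg := Or.inr ha
  have haN := (H.Gg_mem ha').2.1
  obtain ⟨h1, h2⟩ := h a ha
  constructor
  · intro b hb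
    rw [F.G, F.i] at hb
    rw [F.hm ha', F.hm (Or.inl (H.mem_G_i (by omega) hb))]
    exact h1 b hb
  · intro b hb
    rw [Gg, F.G, F.i, F.done] at hb
    have hbN := (H.Gg_mem hb).2.1
    rw [F.G, F.i, F.sig b hbN, F.sig a haN, F.hm ha', F.hm hb, F.satisfiesF5_iff H hb]
    intro h3 h4 h5 h6 h7
    exact h2 b hb h3 h4 h5 h6 (mt (F.satisfiesRewritten hbN) h7)

end Frame

/-! ### Preservation of the invariant -/

theorem Inv.frame_setPoly (H : Inv ord f m D s) {h : ℕ} (hh : h ∈ s.toDo)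
    (p : MvPolynomial (Fin n) K) : Frame s (s.setPoly h p) := by
  refine ⟨rfl, rfl, rfl, le_rfl, fun k _ => sig_setPoly h p k, fun k hk => ?_⟩
  refine poly_setPoly_of_ne ?_ p
  rintro rfl
  have := H.toDo_mem k hh
  exact hk.elim this.2.2.2.1 this.2.2.2.2

theorem Inv.setPoly (H : Inv ord f m D s) {h : ℕ} (hh : h ∈ s.toDo)
    {p : MvPolynomial (Fin n) K} (hsig : HasSig ord f m p (s.sig h))
    (hhom : p.IsHomogeneous ((s.sig h).mon.degree + D (s.sig h).idx)) :
    Inv ord f m D (s.setPoly h p) := by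
  have F := H.frame_setPoly hh p
  have hS : (s.setPoly h p).sig = s.sig := funext fun k => sig_setPoly h p k
  exact {
    one_le_i := H.one_le_i
    i_le := H.i_le
    m_le := H.m_le
    sig_input := by rw [hS]; exact H.sig_input
    poly_input := fun k hk => by
      have hne : k ≠ h := by
        have := (H.toDo_mem h hh).1
        omega
      rw [poly_setPoly_of_ne hne]
      exact H.poly_input k hk
    idx_le := by rw [hS]; exact H.idx_le
    le_idx := by rw [hS]; exact H.le_idx
    mem_rule := by rw [hS]; exact H.mem_rule
    rule_sorted := H.rule_sorted
    hasSig := fun k h1 hN => by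
      rw [hS]
      by_cases hk : k = h
      · subst hk
        rwa [poly_setPoly_self]
      · rw [poly_setPoly_of_ne hk]
        exact H.hasSig k h1 hN
    homog := fun k h1 hN => by
      rw [hS]
      by_cases hk : k = h
      · subst hk
        rwa [poly_setPoly_self]
      · rw [poly_setPoly_of_ne hk]
        exact H.homog k h1 hN
    G_eq := by rw [hS]; exact H.G_eq
    G_mem := fun k hk => by
      rw [F.poly k (Or.inl hk)]
      exact H.G_mem k hk
    toDo_mem := by rw [hS]; exact H.toDo_mem
    done_mem := fun k hk => by
      rw [F.poly k (Or.inr hk), hS]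
      exact H.done_mem k hk
    covered := fun k h1 hN hi => by
      rw [hS] at hi
      by_cases hk : k = h
      · subst hk
        exact Or.inr (Or.inr (Or.inl hh))
      · rw [poly_setPoly_of_ne hk]
        exact H.covered k h1 hN hi
    isPair := fun p' hp' => F.isPair H (H.isPair p' hp')
    complete := F.complete H rfl rfl
    not_lt := by rw [hS]; exact H.not_lt }

theorem Inv.frame_push (H : Inv ord f m D s) (r : LabeledPoly n K) (T : Set ℕ) :
    Frame s { s.push r with toDo := T } :=
  ⟨rfl, rfl, rfl, Nat.le_succ _, fun _ hk => sig_push_of_le r hk,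
    fun _ hk => poly_push_of_le r (H.Gg_mem hk).2.1⟩

theorem Inv.push (H : Inv ord f m D s) {r : LabeledPoly n K} (hi : r.sig.idx = s.i)
    (hsig : HasSig ord f m r.poly r.sig)
    (hhom : r.poly.IsHomogeneous (r.sig.mon.degree + D r.sig.idx))
    (hlt : ∀ a ∈ s.done, ¬ Sig.Lt ord r.sig (s.sig a)) :
    Inv ord f m D { s.push r with toDo := insert (s.N + 1) s.toDo } := by
  have F := H.frame_push r (insert (s.N + 1) s.toDo)
  have hm := H.m_le
  have hGN : ∀ k ∈ s.G s.i, k ≤ s.N := fun k hk => (H.G_mem k hk).2.1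
  have hcase : ∀ {motive : ℕ → Prop}, (∀ k ≤ s.N, motive k) → motive (s.N + 1) →
      ∀ k ≤ s.N + 1, motive k := fun h1 h2 k hk => by
    rcases Nat.le_succ_iff.1 hk with hk | rfl
    · exact h1 k hk
    · exact h2
  exact {
    one_le_i := H.one_le_i
    i_le := H.i_le
    m_le := hm.trans (Nat.le_succ _)
    sig_input := fun k hk => (sig_push_of_le r (hk.trans hm)).trans (H.sig_input k hk)
    poly_input := fun k hk => (poly_push_of_le r (hk.trans hm)).trans (H.poly_input k hk)
    idx_le := hcase (fun k hk => by
        change ((s.push r).sig k).idx ≤ m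
        rw [sig_push_of_le r hk]
        exact H.idx_le k hk) (by
        change ((s.push r).sig (s.N + 1)).idx ≤ m
        rw [sig_push_self, hi]
        exact H.i_le)
    le_idx := fun k hmk hk => by
      revert hmk
      refine hcase (motive := fun k => m < k → s.i ≤ ((s.push r).sig k).idx)
        (fun k hk hmk => ?_) (fun _ => ?_) k hk
      · rw [sig_push_of_le r hk]
        exact H.le_idx k hmk hk
      · rw [sig_push_self, hi]
    mem_rule := fun j x => by
      change x ∈ Function.update s.rule r.sig.idx _ j ↔
        m < x.2 ∧ x.2 ≤ s.N + 1 ∧ (s.push r).sig x.2 = ⟨x.1, j⟩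
      have hold : m < x.2 ∧ x.2 ≤ s.N + 1 ∧ (s.push r).sig x.2 = ⟨x.1, j⟩ ↔
          (x.2 = s.N + 1 ∧ r.sig = ⟨x.1, j⟩) ∨ x ∈ s.rule j := by
        rw [H.mem_rule]
        by_cases hx : x.2 = s.N + 1
        · rw [hx, sig_push_self]
          simp only [le_refl, true_and]
          constructor
          · exact fun h => Or.inl h.2
          · rintro (h | h)
            · exact ⟨by omega, h⟩
            · omega
        · simp only [hx, false_and, false_or]
          constructor
          · rintro ⟨h1, h2, h3⟩
            have : x.2 ≤ s.N := by omega
            exact ⟨h1, this, (sig_push_of_le r this) ▸ h3⟩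
          · rintro ⟨h1, h2, h3⟩
            exact ⟨h1, by omega, (sig_push_of_le r h2).trans h3⟩
      rw [hold]
      by_cases hj : j = r.sig.idx
      · subst hj
        rw [Function.update_self, List.mem_cons]
        refine or_congr ?_ Iff.rfl
        rw [Prod.ext_iff, Sig.ext_iff]
        constructor
        · rintro ⟨h1, h2⟩
          exact ⟨h2, h1.symm, rfl⟩
        · rintro ⟨h1, h2, -⟩
          exact ⟨h2.symm, h1⟩
      · rw [Function.update_of_ne hj]
        refine ⟨Or.inr, ?_⟩
        rintro (⟨-, h⟩ | h)
        · exact absurd (congrArg Sig.idx h).symm hj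
        · exact h
    rule_sorted := fun j => by
      change (Function.update s.rule r.sig.idx _ j).Pairwise _
      by_cases hj : j = r.sig.idx
      · subst hj
        rw [Function.update_self, List.pairwise_cons]
        refine ⟨fun y hy => ?_, H.rule_sorted _⟩
        exact Nat.lt_succ_of_le ((H.mem_rule _ _).1 hy).2.1
      · rw [Function.update_of_ne hj]
        exact H.rule_sorted j
    hasSig := fun k h1 hk => by
      revert h1
      refine hcase (motive := fun k => 1 ≤ k → HasSig ord f m ((s.push r).poly k)
        ((s.push r).sig k)) (fun k hk h1 => ?_) (fun _ => ?_) k hk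
      · rw [sig_push_of_le r hk, poly_push_of_le r hk]
        exact H.hasSig k h1 hk
      · rwa [sig_push_self, poly_push_self]
    homog := fun k h1 hk => by
      revert h1
      refine hcase (motive := fun k => 1 ≤ k → ((s.push r).poly k).IsHomogeneous
        (((s.push r).sig k).mon.degree + D ((s.push r).sig k).idx))
        (fun k hk h1 => ?_) (fun _ => ?_) k hk
      · rw [sig_push_of_le r hk, poly_push_of_le r hk]
        exact H.homog k h1 hk
      · rwa [sig_push_self, poly_push_self]
    G_eq := fun j hj => by
      change s.G j = {k | k ∈ s.G s.i ∧ j ≤ ((s.push r).sig k).idx}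
      rw [H.G_eq j hj]
      ext k
      refine and_congr_right fun hk => ?_
      rw [sig_push_of_le r (hGN k hk)]
    G_mem := fun k hk => by
      obtain ⟨h1, h2, h3⟩ := H.G_mem k hk
      exact ⟨h1, h2.trans (Nat.le_succ _), fun h => h3 ((poly_push_of_le r h2).symm.trans h)⟩
    toDo_mem := fun k hk => by
      change m < k ∧ k ≤ s.N + 1 ∧ ((s.push r).sig k).idx = s.i ∧ k ∉ s.G s.i ∧ k ∉ s.done
      rcases hk with rfl | hk
      · rw [sig_push_self]
        refine ⟨by omega, le_rfl, hi, fun h => ?_, fun h => ?_⟩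
        · have := hGN _ h
          omega
        · have := (H.done_mem _ h).2.1
          omega
      · obtain ⟨h1, h2, h3⟩ := H.toDo_mem k hk
        rw [sig_push_of_le r h2]
        exact ⟨h1, by omega, h3⟩
    done_mem := fun k hk => by
      obtain ⟨h1, h2, h3⟩ := H.done_mem k hk
      change m < k ∧ k ≤ s.N + 1 ∧ ((s.push r).sig k).idx = s.i ∧ k ∉ s.G s.i ∧
        (s.push r).poly k ≠ 0
      rw [poly_push_of_le r h2, sig_push_of_le r h2]
      exact ⟨h1, h2.trans (Nat.le_succ _), h3⟩
    covered := fun k h1 hk => by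
      change s.i ≤ ((s.push r).sig k).idx → k ∈ s.G s.i ∨ k ∈ s.done ∨
        k ∈ insert (s.N + 1) s.toDo ∨ (s.push r).poly k = 0
      revert h1
      refine hcase (motive := fun k => 1 ≤ k → s.i ≤ ((s.push r).sig k).idx → k ∈ s.G s.i ∨
        k ∈ s.done ∨ k ∈ insert (s.N + 1) s.toDo ∨ (s.push r).poly k = 0)
        (fun k hk h1 => ?_) (fun _ _ => ?_) k hk
      · rw [sig_push_of_le r hk, poly_push_of_le r hk]
        intro h
        have := H.covered k h1 hk h
        rw [Set.mem_insert_iff]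
        tauto
      · exact Or.inr (Or.inr (Or.inl (Set.mem_insert _ _)))
    isPair := fun p' hp' => F.isPair H (H.isPair p' hp')
    complete := F.complete H rfl rfl
    not_lt := fun a ha x hx => by
      change ¬ Sig.Lt ord ((s.push r).sig x) ((s.push r).sig a)
      rw [sig_push_of_le r (H.done_mem a ha).2.1]
      rcases hx with rfl | hx
      · rw [sig_push_self]
        exact hlt a ha
      · rw [sig_push_of_le r (H.toDo_mem x hx).2.1]
        exact H.not_lt a ha x hx }

/-- A pair with a rewritten part can be discarded. -/
theorem Inv.erase_pair (H : Inv ord f m D s) {p : CritPair n}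
    (hrw : s.SatisfiesRewritten p.u₁ p.r₁ ∨ s.SatisfiesRewritten p.u₂ p.r₂) :
    Inv ord f m D { s with Pd := s.Pd \ {p} } :=
  { H with
    isPair := fun p' hp' => by
      have := H.isPair p' (hp'.imp_right fun h => h.1)
      exact ⟨this.eq, this.mem₁, this.mem₂, this.idx, this.not_lt, this.ne⟩
    complete := fun a ha b hb hab => by
      have hab' : Needed ord s a b := ⟨hab.lt, hab.f5₁, hab.f5₂, hab.rw₁, hab.rw₂⟩
      obtain ⟨h1, h2⟩ := H.complete a ha b hb hab'
      refine ⟨h1, h2.imp_right fun h => ⟨h, ?_⟩⟩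
      rintro (h' : s.mkPair ord a b = p)
      subst h'
      exact hrw.elim hab'.rw₁ hab'.rw₂ }

end Inv

/-! ### The individual steps of the algorithm. -/

section Step

variable {n : ℕ} {K : Type*} [Field K] {ord : MonomialOrder (Fin n)}
  {f : ℕ → MvPolynomial (Fin n) K} {m : ℕ} {D : ℕ → ℕ} {s : State n K}

theorem inv_init (hm : 1 ≤ m) (hf : ∀ i, 1 ≤ i → i ≤ m → f i ≠ 0 ∧ (f i).IsHomogeneous (D i)) :
    Inv ord f m D (init f m) where
  one_le_i := hm
  i_le := le_rfl
  m_le := le_rfl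
  sig_input := fun _ _ => rfl
  poly_input := fun _ _ => rfl
  idx_le := fun _ hk => hk
  le_idx := fun k h1 (h2 : k ≤ m) => absurd h1 h2.not_gt
  mem_rule := fun j x => by
    refine ⟨fun h => absurd h List.not_mem_nil, fun ⟨h1, (h2 : x.2 ≤ m), _⟩ => ?_⟩
    exact absurd h1 h2.not_gt
  rule_sorted := fun _ => List.Pairwise.nil
  hasSig := fun k _ _ => hasSig_of_mon_eq_zero (σ := ⟨0, k⟩) rfl
  homog := fun k h1 (h2 : k ≤ m) => by
    have := (hf k h1 h2).2
    change (f k).IsHomogeneous ((0 : Mon n).degree + D k)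
    rwa [map_zero, zero_add]
  G_eq := fun j (hj : m ≤ j) => by
    change (if j = m then ({m} : Set ℕ) else ∅) =
      {k | k ∈ (if m = m then ({m} : Set ℕ) else ∅) ∧ j ≤ k}
    ext k
    by_cases h : j = m
    · subst h
      simp only [if_true, Set.mem_singleton_iff, Set.mem_ofPred_eq, iff_self_and]
      exact fun h => h.ge
    · simp only [h, if_false, if_true, Set.mem_empty_iff_false, Set.mem_singleton_iff,
        Set.mem_ofPred_eq, false_iff]
      omega
  G_mem := fun k hk => by
    change k ∈ (if m = m then ({m} : Set ℕ) else ∅) at hk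
    rw [if_pos rfl, Set.mem_singleton_iff] at hk
    subst hk
    exact ⟨hm, le_rfl, (hf k hm le_rfl).1⟩
  toDo_mem := fun k hk => absurd hk (Set.notMem_empty k)
  done_mem := fun k hk => absurd hk (Set.notMem_empty k)
  covered := fun k _ (h2 : k ≤ m) (h3 : m ≤ k) => by
    left
    change k ∈ (if m = m then ({m} : Set ℕ) else ∅)
    rw [if_pos rfl, Set.mem_singleton_iff]
    omega
  isPair := fun p hp => absurd hp (by simp [init])
  complete := fun a ha b hb hab => by
    change a ∈ (if m = m then ({m} : Set ℕ) else ∅) at ha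
    change b ∈ (if m = m then ({m} : Set ℕ) else ∅) at hb
    rw [if_pos rfl, Set.mem_singleton_iff] at ha hb
    subst ha hb
    exact absurd hab (not_needed_self _)
  not_lt := fun a ha => absurd ha (Set.notMem_empty a)

/-- As no pairs are left over, `complete` says that no pair within the old G_i is needed. A needed
pair therefore contains r_j, and as its first part, because the smaller index gives the greater
signature. -/
theorem Inv.call (H : Inv ord f m D s) (hf : ∀ i, 1 ≤ i → i ≤ m → f i ≠ 0) {j : ℕ}
    (hj : 1 ≤ j) (hi : s.i = j + 1) (hP : s.P = ∅) (hPd : s.Pd = ∅) (htoDo : s.toDo = ∅)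
    (hdone : s.done = ∅) {s' : State n K}
    (hs' : s' = { s with i := j, G := Function.update s.G j (insert j (s.G s.i)) }) :
    Inv ord f m D
      { s' with
        place := Place.loop
        P := { p | ∃ r ∈ s.G s.i, p ∈ s'.critPair ord j r } } := by
  have hjm : j < m := by
    have := H.i_le
    omega
  have hm := H.m_le
  have hsj : s.sig j = ⟨0, j⟩ := H.sig_input j hjm.le
  have hGj : s'.G j = insert j (s.G s.i) := by
    rw [hs']
    exact Function.update_self ..
  have hG : ∀ k, k ≠ j → s'.G k = s.G k := fun k hk => by
    rw [hs']
    exact Function.update_of_ne hk _ _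
  have hGi : ∀ k ∈ s.G s.i, j < (s.sig k).idx := fun k hk => by
    have := H.le_idx_of_mem_G le_rfl hk
    omega
  have hjG : j ∉ s.G s.i := fun h => by
    have := hGi j h
    rw [hsj] at this
    exact lt_irrefl _ this
  have hidx : ∀ k ∈ insert j (s.G s.i), j ≤ (s.sig k).idx := by
    rintro k (rfl | hk)
    · rw [hsj]
    · exact (hGi k hk).le
  have hGN : ∀ k ∈ insert j (s.G s.i), 1 ≤ k ∧ k ≤ s.N ∧ s.poly k ≠ 0 := by
    rintro k (rfl | hk)
    · refine ⟨hj, by omega, ?_⟩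
      rw [H.poly_input _ hjm.le]
      exact hf _ hj hjm.le
    · exact H.G_mem k hk
  -- For an element of index at least j the criterion only looks at sets beyond G_j, which the
  -- update leaves alone.
  have hF5 : ∀ t, ∀ k ∈ insert j (s.G s.i), s'.SatisfiesF5 ord t k ↔ s.SatisfiesF5 ord t k := by
    intro t k hk
    have := hG ((s.sig k).idx + 1) (by have := hidx k hk; omega)
    simp only [SatisfiesF5, phiFixes_iff]
    subst hs'
    change (¬ ∀ b ∈ Function.update s.G j (insert j (s.G s.i)) ((s.sig k).idx + 1), _) ↔ _
    rw [← this]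
    rfl
  have hspec : ∀ r ∈ s.G s.i, ∀ p ∈ s'.critPair ord j r, IsPair ord s' p := by
    intro r hr p hp
    have hi' : s'.i = j := by rw [hs']
    have hsig : s'.sig = s.sig := by
      rw [hs']
      rfl
    obtain ⟨h1, h2, h3, h4, h5⟩ := isPair_of_mem_critPair hp (by rintro rfl; exact hjG hr)
      (by rw [hi', hsig, hsj]) (by rw [hi', hsig]; exact (hGi r hr).le)
    have hrG : r ∈ s'.G s'.i := by
      rw [hi', hGj]
      exact Or.inr hr
    have hjG : j ∈ s'.G s'.i := by
      rw [hi', hGj]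
      exact Or.inl rfl
    rcases h2 with ⟨h2, h2'⟩ | ⟨h2, h2'⟩
    · exact ⟨h1, h2 ▸ hjG, h2' ▸ hrG, h3, h4, h5⟩
    · exact ⟨h1, h2 ▸ hrG, h2' ▸ hjG, h3, h4, h5⟩
  have hneed : ∀ a ∈ insert j (s.G s.i), ∀ b ∈ insert j (s.G s.i), Needed ord s' a b →
      a = j ∧ b ∈ s.G s.i ∧ s'.mkPair ord a b ∈ s'.critPair ord j b := by
    intro a ha b hb hab
    have hab' : Needed ord s a b := by
      have h2 := mt (hF5 _ a ha).2 hab.f5₁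
      have h3 := mt (hF5 _ b hb).2 hab.f5₂
      obtain ⟨h1, -, -, h4, h5⟩ := hab
      subst hs'
      exact ⟨h1, h2, h3, h4, h5⟩
    have hlt : (s.sig a).idx ≤ (s.sig b).idx := hab'.lt.idx_le
    rcases ha with rfl | ha
    · rcases hb with rfl | hb
      · exact absurd hab' (not_needed_self _)
      · refine ⟨rfl, hb, (hab.mem_critPair ?_).1⟩
        subst hs'
        exact congrArg Sig.idx hsj
    · rcases hb with rfl | hb
      · rw [hsj] at hlt
        exact absurd (hGi a ha) hlt.not_gt
      · have := (H.complete a ha b hb hab').2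
        rw [hP, hPd, Set.union_empty] at this
        exact absurd this (Set.notMem_empty _)
  subst hs'
  exact { H with
    one_le_i := hj
    i_le := hjm.le
    le_idx := fun k h1 h2 => by
      have := H.le_idx k h1 h2
      change j ≤ (s.sig k).idx
      omega
    G_eq := fun j' (hj' : j ≤ j') => by
      change Function.update s.G j (insert j (s.G s.i)) j' =
        {k | k ∈ Function.update s.G j (insert j (s.G s.i)) j ∧ j' ≤ (s.sig k).idx}
      rw [Function.update_self]
      ext k
      rw [Set.mem_ofPred_eq]
      by_cases h : j' = j
      · subst h
        rw [Function.update_self]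
        exact ⟨fun h => ⟨h, hidx k h⟩, fun h => h.1⟩
      · rw [Function.update_of_ne h, H.G_eq j' (by omega), Set.mem_ofPred_eq]
        refine ⟨fun h => ⟨Or.inr h.1, h.2⟩, ?_⟩
        rintro ⟨rfl | h1, h2⟩
        · rw [hsj] at h2
          exact absurd (le_antisymm h2 hj') h
        · exact ⟨h1, h2⟩
    G_mem := fun k hk => by
      change k ∈ Function.update s.G j (insert j (s.G s.i)) j at hk
      rw [Function.update_self] at hk
      exact hGN k hk
    toDo_mem := fun k (hk : k ∈ s.toDo) => by
      rw [htoDo] at hk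
      exact absurd hk (Set.notMem_empty _)
    done_mem := fun k (hk : k ∈ s.done) => by
      rw [hdone] at hk
      exact absurd hk (Set.notMem_empty _)
    covered := fun k h1 h2 (h3 : j ≤ (s.sig k).idx) => by
      change k ∈ Function.update s.G j (insert j (s.G s.i)) j ∨ k ∈ s.done ∨ k ∈ s.toDo ∨
        s.poly k = 0
      rw [Function.update_self]
      -- Positions beyond `m` have index at least j + 1, so r_j is the only position of index j.
      by_cases h : (s.sig k).idx = j
      · left
        left
        by_cases hk : k ≤ m
        · rw [H.sig_input k hk] at h
          exact h
        · have := H.le_idx k (by omega) h2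
          omega
      · exact (H.covered k h1 h2 (by omega)).imp_left Or.inr
    isPair := by
      rintro p (⟨r, hr, hp⟩ | hp)
      · have := hspec r hr p hp
        exact ⟨this.eq, this.mem₁, this.mem₂, this.idx, this.not_lt, this.ne⟩
      · change p ∈ s.Pd at hp
        rw [hPd] at hp
        exact absurd hp (Set.notMem_empty _)
    complete := fun a ha b hb hab => by
      have ha' := ha
      have hb' := hb
      change a ∈ Function.update s.G j (insert j (s.G s.i)) j at ha'
      change b ∈ Function.update s.G j (insert j (s.G s.i)) j at hb'
      rw [Function.update_self] at ha' hb'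
      obtain ⟨h1, h2, h3⟩ := hneed a ha' b hb' ⟨hab.lt, hab.f5₁, hab.f5₂, hab.rw₁, hab.rw₂⟩
      exact ⟨by rw [h1]; exact congrArg Sig.idx hsj, Or.inl ⟨b, h2, h3⟩⟩
    not_lt := fun k (hk : k ∈ s.done) => by
      rw [hdone] at hk
      exact absurd hk (Set.notMem_empty _) }

/-- Needed pairs without r are already waiting. Those with r are produced by `CritPair` in either
orientation; if r is the second part, the first has index i as well, its signature being greater. -/
theorem Inv.move (H : Inv ord f m D s) (htoDo : s.toDo = ∅) {r : ℕ} (hr : r ∈ s.done) :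
    Inv ord f m D
      { s with
        done := s.done \ {r}
        P := s.P ∪ { p | ∃ r' ∈ s.G s.i, p ∈ s.critPair ord r r' }
        G := Function.update s.G s.i (insert r (s.G s.i)) } := by
  obtain ⟨hmr, hrN, hri, hrG, hr0⟩ := H.done_mem r hr
  have hm := H.m_le
  have hidx : ∀ k ∈ insert r (s.G s.i), s.i ≤ (s.sig k).idx := by
    rintro k (rfl | hk)
    · exact hri.ge
    · exact H.le_idx_of_mem_G le_rfl hk
  have hneed : ∀ a ∈ insert r (s.G s.i), ∀ b ∈ insert r (s.G s.i), Needed ord s a b →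
      (s.sig a).idx = s.i ∧ (s.mkPair ord a b ∈ s.P ∪ s.Pd ∨
        ∃ r' ∈ s.G s.i, s.mkPair ord a b ∈ s.critPair ord r r') := by
    intro a ha b hb hab
    have hlt : (s.sig a).idx ≤ (s.sig b).idx := hab.lt.idx_le
    rcases ha with rfl | ha <;> rcases hb with rfl | hb
    · exact absurd hab (not_needed_self _)
    · exact ⟨hri, Or.inr ⟨b, hb, (hab.mem_critPair hri).1⟩⟩
    · have := le_antisymm (hlt.trans hri.le) (H.le_idx_of_mem_G le_rfl ha)
      exact ⟨this, Or.inr ⟨a, ha, (hab.mem_critPair this).2⟩⟩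
    · exact (H.complete a ha b hb hab).imp_right Or.inl
  have hsub : s.G s.i ⊆ Function.update s.G s.i (insert r (s.G s.i)) s.i := by
    rw [Function.update_self]
    exact Set.subset_insert _ _
  have hmem : r ∈ Function.update s.G s.i (insert r (s.G s.i)) s.i := by
    rw [Function.update_self]
    exact Set.mem_insert _ _
  exact { H with
    G_eq := fun j (hj : s.i ≤ j) => by
      change Function.update s.G s.i (insert r (s.G s.i)) j =
        {k | k ∈ Function.update s.G s.i (insert r (s.G s.i)) s.i ∧ j ≤ (s.sig k).idx}
      rw [Function.update_self]
      ext k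
      rw [Set.mem_ofPred_eq]
      by_cases h : j = s.i
      · subst h
        rw [Function.update_self]
        exact ⟨fun h => ⟨h, hidx k h⟩, fun h => h.1⟩
      · rw [Function.update_of_ne h, H.G_eq j hj, Set.mem_ofPred_eq]
        refine ⟨fun h => ⟨Or.inr h.1, h.2⟩, ?_⟩
        rintro ⟨rfl | h1, h2⟩
        · omega
        · exact ⟨h1, h2⟩
    G_mem := fun k hk => by
      change k ∈ Function.update s.G s.i (insert r (s.G s.i)) s.i at hk
      rw [Function.update_self] at hk
      rcases hk with rfl | hk
      · exact ⟨by omega, hrN, hr0⟩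
      · exact H.G_mem k hk
    toDo_mem := fun k (hk : k ∈ s.toDo) => by
      rw [htoDo] at hk
      exact absurd hk (Set.notMem_empty _)
    done_mem := fun k hk => by
      obtain ⟨h1, h2, h3, h4, h5⟩ := H.done_mem k hk.1
      refine ⟨h1, h2, h3, fun h => ?_, h5⟩
      change k ∈ Function.update s.G s.i (insert r (s.G s.i)) s.i at h
      rw [Function.update_self] at h
      exact h.elim hk.2 h4
    covered := fun k h1 h2 h3 => by
      rcases H.covered k h1 h2 h3 with h | h | h
      · exact Or.inl (hsub h)
      · by_cases hk : k = r
        · exact Or.inl (hk ▸ hmem)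
        · exact Or.inr (Or.inl ⟨h, hk⟩)
      · exact Or.inr (Or.inr h)
    isPair := by
      have hold : ∀ p ∈ s.P ∪ s.Pd, IsPair ord { s with
          done := s.done \ {r}
          P := s.P ∪ { p | ∃ r' ∈ s.G s.i, p ∈ s.critPair ord r r' }
          G := Function.update s.G s.i (insert r (s.G s.i)) } p := fun p hp => by
        have := H.isPair p hp
        exact ⟨this.eq, hsub this.mem₁, hsub this.mem₂, this.idx, this.not_lt, this.ne⟩
      rintro p ((hp | ⟨r', hr', hp⟩) | hp)
      · exact hold p (Or.inl hp)
      · obtain ⟨h1, h2, h3, h4, h5⟩ := isPair_of_mem_critPair hp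
          (by rintro rfl; exact hrG hr') hri.ge (H.le_idx_of_mem_G le_rfl hr')
        rcases h2 with ⟨h2, h2'⟩ | ⟨h2, h2'⟩
        · exact ⟨h1, h2 ▸ hmem, h2' ▸ hsub hr', h3, h4, h5⟩
        · exact ⟨h1, h2 ▸ hsub hr', h2' ▸ hmem, h3, h4, h5⟩
      · exact hold p (Or.inr hp)
    complete := fun a ha b hb hab => by
      change a ∈ Function.update s.G s.i (insert r (s.G s.i)) s.i at ha
      change b ∈ Function.update s.G s.i (insert r (s.G s.i)) s.i at hb
      rw [Function.update_self] at ha hb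
      have hF5 : ∀ t, ∀ k ∈ insert r (s.G s.i), s.SatisfiesF5 ord t k →
          State.SatisfiesF5 ord { s with
            done := s.done \ {r}
            P := s.P ∪ { p | ∃ r' ∈ s.G s.i, p ∈ s.critPair ord r r' }
            G := Function.update s.G s.i (insert r (s.G s.i)) } t k := by
        intro t k hk h
        simp only [SatisfiesF5, phiFixes_iff] at h ⊢
        change ¬ ∀ b ∈ Function.update s.G s.i (insert r (s.G s.i)) ((s.sig k).idx + 1), _
        rw [Function.update_of_ne (by have := hidx k hk; omega)]
        exact h
      obtain ⟨h1, h2⟩ := hneed a ha b hb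
        ⟨hab.lt, mt (hF5 _ a ha) hab.f5₁, mt (hF5 _ b hb) hab.f5₂, hab.rw₁, hab.rw₂⟩
      refine ⟨h1, ?_⟩
      rcases h2 with (h2 | h2) | h2
      · exact Or.inl (Or.inl h2)
      · exact Or.inr h2
      · exact Or.inl (Or.inr h2)
    not_lt := fun a ha => H.not_lt a ha.1 }

theorem Inv.drop_toDo (H : Inv ord f m D s) {h : ℕ} (h0 : s.poly h = 0) :
    Inv ord f m D { s with toDo := s.toDo \ {h} } :=
  { H with
    toDo_mem := fun k hk => H.toDo_mem k hk.1
    covered := fun k h1 h2 h3 => by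
      rcases H.covered k h1 h2 h3 with h4 | h4 | h4 | h4
      · exact Or.inl h4
      · exact Or.inr (Or.inl h4)
      · by_cases hk : k = h
        · subst hk
          exact Or.inr (Or.inr (Or.inr h0))
        · exact Or.inr (Or.inr (Or.inl ⟨h4, hk⟩))
      · exact Or.inr (Or.inr (Or.inr h4))
    isPair := fun p hp => by
      have := H.isPair p hp
      exact ⟨this.eq, this.mem₁, this.mem₂, this.idx, this.not_lt, this.ne⟩
    complete := fun a ha b hb hab =>
      H.complete a ha b hb ⟨hab.lt, hab.f5₁, hab.f5₂, hab.rw₁, hab.rw₂⟩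
    not_lt := fun a ha x hx => H.not_lt a ha x hx.1 }

theorem Inv.finish_toDo (H : Inv ord f m D s) {h : ℕ} (hh : h ∈ s.toDo) (h0 : s.poly h ≠ 0)
    (hmin : ∀ k ∈ s.toDo, ¬ Sig.Lt ord (s.sig k) (s.sig h)) :
    Inv ord f m D { s with toDo := s.toDo \ {h}, done := insert h s.done } :=
  { H with
    toDo_mem := fun k hk => by
      obtain ⟨h1, h2, h3, h4, h5⟩ := H.toDo_mem k hk.1
      exact ⟨h1, h2, h3, h4, fun h => h.elim hk.2 h5⟩
    done_mem := fun k hk => by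
      rcases hk with rfl | hk
      · obtain ⟨h1, h2, h3, h4, -⟩ := H.toDo_mem k hh
        exact ⟨h1, h2, h3, h4, h0⟩
      · exact H.done_mem k hk
    covered := fun k h1 h2 h3 => by
      rcases H.covered k h1 h2 h3 with h4 | h4 | h4 | h4
      · exact Or.inl h4
      · exact Or.inr (Or.inl (Or.inr h4))
      · by_cases hk : k = h
        · exact Or.inr (Or.inl (Or.inl hk))
        · exact Or.inr (Or.inr (Or.inl ⟨h4, hk⟩))
      · exact Or.inr (Or.inr (Or.inr h4))
    isPair := fun p hp => by
      have := H.isPair p hp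
      exact ⟨this.eq, this.mem₁, this.mem₂, this.idx, this.not_lt, this.ne⟩
    complete := fun a ha b hb hab =>
      H.complete a ha b hb ⟨hab.lt, hab.f5₁, hab.f5₂, hab.rw₁, hab.rw₂⟩
    not_lt := fun a ha x hx => by
      rcases ha with rfl | ha
      · exact hmin x hx.1
      · exact H.not_lt a ha x hx.1 }

/-- Reduction by G_{i+1} subtracts elements of `beyond f m s.i`, which lie below every signature of
index i, so the label remains valid. -/
theorem Inv.normalForm (H : Inv ord f m D s) {h : ℕ} {q : MvPolynomial (Fin n) K}
    (hh : s.Takes ord h q) :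
    HasSig ord f m q (s.sig h) ∧
      q.IsHomogeneous ((s.sig h).mon.degree + D (s.sig h).idx) ∧
      (q ≠ 0 → ∀ b ∈ s.G (s.i + 1), ¬ s.hm ord b ≤ ord.degree q) := by
  obtain ⟨h1, hN, hi, -⟩ := H.toDo_mem h hh.mem
  have hB : ∀ b ∈ s.G (s.i + 1), b ∈ s.Gg ∧ s.i + 1 ≤ (s.sig b).idx := fun b hb =>
    ⟨Or.inl (H.mem_G_i (by omega) hb), H.le_idx_of_mem_G (by omega) hb⟩
  have h1' : 1 ≤ h := by omega
  refine ⟨?_, ?_, fun hq b hb => ?_⟩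
  · have hmem : s.poly h - q ∈ beyond f m s.i := by
      refine hh.nf.sub_mem_beyond ?_
      rintro _ ⟨b, hb, rfl⟩
      obtain ⟨hbG, hbi⟩ := hB b hb
      have := H.Gg_mem hbG
      exact (H.hasSig b this.1 this.2.1).mem_beyond (H.idx_le b this.2.1) hbi
    have := (H.hasSig h h1' hN).sub_of_mem_below (beyond_le_below hi.le hmem)
    rwa [sub_sub_cancel] at this
  · refine hh.nf.isHomogeneous ?_ (H.homog h h1' hN)
    rintro _ ⟨b, hb, rfl⟩
    have := H.Gg_mem (hB b hb).1
    exact ⟨_, H.homog b this.1 this.2.1⟩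
  · exact hh.nf.not_degree_le hq ⟨b, hb, rfl⟩ (H.Gg_mem (hB b hb).1).2.2.2

/-- By homogeneity the signature determines the degree of the head monomial; all degree arguments
rest on this. -/
theorem Inv.degree_hm (H : Inv ord f m D s) {k : ℕ} (hk : k ∈ s.Gg) :
    (s.hm ord k).degree = (s.sig k).mon.degree + D (s.sig k).idx := by
  have := H.Gg_mem hk
  exact degree_degree_of_isHomogeneous (H.homog k this.1 this.2.1) this.2.2.2

theorem Inv.homog_monomial_mul (H : Inv ord f m D s) {k : ℕ} (hk : k ∈ s.Gg) (u : Mon n) (c : K) :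
    (monomial u c * s.poly k).IsHomogeneous (u + s.hm ord k).degree := by
  have := H.Gg_mem hk
  rw [map_add, H.degree_hm hk]
  exact (isHomogeneous_monomial _ rfl).mul (H.homog k this.1 this.2.1)

theorem Inv.degree_mul_sig (H : Inv ord f m D s) {k : ℕ} (hk : k ∈ s.Gg) (u : Mon n) :
    (Sig.mul u (s.sig k)).mon.degree + D (s.sig k).idx = (u + s.hm ord k).degree := by
  rw [map_add, H.degree_hm hk, Sig.mul, map_add, add_assoc]

theorem Inv.leadingCoeff_ne_zero (H : Inv ord f m D s) {k : ℕ} (hk : k ∈ s.Gg) :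
    ord.leadingCoeff (s.poly k) ≠ 0 :=
  ord.leadingCoeff_ne_zero_iff.2 (H.Gg_mem hk).2.2.2

theorem HasDegree.of_eq {d : ℕ} {s s' : State n K} (h : HasDegree D s d) (hP : s'.P ⊆ s.P)
    (hPd : s'.Pd ⊆ s.Pd) (hi : s'.i = s.i)
    (hmem : ∀ k ∈ s'.toDo ∪ s'.done, (k ∈ s.toDo ∪ s.done ∧ s'.sig k = s.sig k) ∨
      (s'.sig k).mon.degree + D s.i = d) : HasDegree D s' d := by
  have : ∀ k ∈ s'.toDo ∪ s'.done, (s'.sig k).mon.degree + D s'.i = d := by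
    intro k hk
    rw [hi]
    rcases hmem k hk with ⟨h1 | h1, h2⟩ | h1
    · rw [h2]
      exact h.toDo k h1
    · rw [h2]
      exact h.done k h1
    · exact h1
  exact ⟨fun p hp => h.P p (hP hp), fun p hp => h.Pd p (hPd hp), fun k hk => this k (Or.inl hk),
    fun k hk => this k (Or.inr hk)⟩

theorem placeInv_spol (h : s.place = Place.spol) :
    PlaceInv ord D s ↔ s.done = ∅ ∧ ∃ d, HasDegree D s d := by
  simp only [PlaceInv, h]

theorem placeInv_reduction (h : s.place = Place.reduction) :
    PlaceInv ord D s ↔ s.Pd = ∅ ∧ (∃ d, HasDegree D s d) ∧ DoneIrreducible ord s := by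
  simp only [PlaceInv, h]

theorem Inv.relocate (H : Inv ord f m D s) (pl : Place) {P' Pd' : Set (CritPair n)} {T E : Set ℕ}
    (hP : P' ∪ Pd' = s.P ∪ s.Pd) (hT : s.toDo = T) (hE : s.done = E) :
    Inv ord f m D { s with place := pl, P := P', Pd := Pd', toDo := T, done := E } := by
  subst hT hE
  exact { H with
    isPair := fun p hp => by
      have := H.isPair p (hP ▸ hp)
      exact ⟨this.eq, this.mem₁, this.mem₂, this.idx, this.not_lt, this.ne⟩
    complete := fun a ha b hb hab => by
      change _ ∧ _ ∈ P' ∪ Pd'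
      rw [hP]
      exact H.complete a ha b hb ⟨hab.lt, hab.f5₁, hab.f5₂, hab.rw₁, hab.rw₂⟩ }

theorem IsPair.u₁_add {p : CritPair n} (h : IsPair ord s p) :
    p.u₁ + s.hm ord p.r₁ = p.t := by
  have := mkPair_u₁_add (ord := ord) (s := s) p.r₁ p.r₂
  rwa [← h.eq] at this

theorem IsPair.u₂_add {p : CritPair n} (h : IsPair ord s p) :
    p.u₂ + s.hm ord p.r₂ = p.t := by
  have := mkPair_u₂_add (ord := ord) (s := s) p.r₁ p.r₂
  rwa [← h.eq] at this

/-- If both parts had the same signature, the one at the earlier position would be rewritten by the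
other. -/
theorem Inv.lt_of_isPair (H : Inv ord f m D s) {p : CritPair n} (hp : IsPair ord s p)
    (h₁ : ¬ s.SatisfiesRewritten p.u₁ p.r₁) (h₂ : ¬ s.SatisfiesRewritten p.u₂ p.r₂) :
    Sig.Lt ord (Sig.mul p.u₂ (s.sig p.r₂)) (Sig.mul p.u₁ (s.sig p.r₁)) := by
  refine Sig.lt_of_not_lt hp.not_lt fun heq => ?_
  have hN₁ := (H.G_mem _ hp.mem₁).2.1
  have hN₂ := (H.G_mem _ hp.mem₂).2.1
  rcases lt_or_gt_of_ne hp.ne with h | h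
  · exact h₁ ⟨p.r₂, h, hN₂, heq ▸ Sig.dvd_mul_self _ _⟩
  · exact h₂ ⟨p.r₁, h, hN₁, heq ▸ Sig.dvd_mul_self _ _⟩

theorem Inv.spolAdd (H : Inv ord f m D s) {p : CritPair n} (hp : IsPair ord s p)
    (h₁ : ¬ s.SatisfiesRewritten p.u₁ p.r₁) (h₂ : ¬ s.SatisfiesRewritten p.u₂ p.r₂)
    (hdone : s.done = ∅) :
    Inv ord f m D { s.push ⟨Sig.mul p.u₁ (s.sig p.r₁), s.spoly ord p⟩ with
      Pd := s.Pd \ {p}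
      toDo := insert (s.N + 1) s.toDo } := by
  have hG₁ : p.r₁ ∈ s.Gg := Or.inl hp.mem₁
  have hG₂ : p.r₂ ∈ s.Gg := Or.inl hp.mem₂
  obtain ⟨hpos₁, hN₁, -⟩ := H.Gg_mem hG₁
  obtain ⟨hpos₂, hN₂, -⟩ := H.Gg_mem hG₂
  have H' := H.push (r := ⟨Sig.mul p.u₁ (s.sig p.r₁), s.spoly ord p⟩) hp.idx ?_ ?_ ?_
  · refine H'.erase_pair (p := p) (Or.inl ⟨s.N + 1, by omega, le_rfl, ?_⟩)
    change Sig.Dvd ((s.push _).sig (s.N + 1)) (Sig.mul _ ((s.push _).sig p.r₁))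
    rw [sig_push_self, sig_push_of_le _ hN₁]
    exact ⟨rfl, le_rfl⟩
  · refine HasSig.sub_of_mem_below ((H.hasSig _ hpos₁ hN₁).monomial_mul _
      (inv_ne_zero (H.leadingCoeff_ne_zero hG₁))) ?_
    exact ((H.hasSig _ hpos₂ hN₂).monomial_mul _
      (inv_ne_zero (H.leadingCoeff_ne_zero hG₂))).mem_below (H.idx_le _ hN₂)
      (H.lt_of_isPair hp h₁ h₂)
  · refine IsHomogeneous.sub ?_ ?_
    · have := H.homog_monomial_mul hG₁ p.u₁ (ord.leadingCoeff (s.poly p.r₁))⁻¹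
      rwa [← H.degree_mul_sig hG₁] at this
    · have := H.homog_monomial_mul hG₂ p.u₂ (ord.leadingCoeff (s.poly p.r₂))⁻¹
      rwa [hp.u₂_add, ← hp.u₁_add, ← H.degree_mul_sig hG₁] at this
  · rw [hdone]
    exact fun a ha => absurd ha (Set.notMem_empty a)

theorem Inv.tsub_add_hm (H : Inv ord f m D s) {h k : ℕ} {q : MvPolynomial (Fin n) K}
    (hh : s.Takes ord h q) (hq : q ≠ 0) (hle : s.hm ord k ≤ ord.degree q) :
    (ord.degree q - s.hm ord k + s.hm ord k).degree =
      (s.sig h).mon.degree + D (s.sig h).idx := by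
  rw [tsub_add_cancel_of_le hle]
  exact degree_degree_of_isHomogeneous (H.normalForm hh).2.1 hq

theorem Inv.reduce (H : Inv ord f m D s) {h k : ℕ} {q : MvPolynomial (Fin n) K}
    (hh : s.Takes ord h q) (hq : q ≠ 0) (hk : k ∈ s.Gg) (hred : s.IsReductor ord h q k)
    (hlt : Sig.Lt ord (Sig.mul (ord.degree q - s.hm ord k) (s.sig k)) (s.sig h)) :
    Inv ord f m D (s.setPoly h (q -
      monomial (ord.degree q - s.hm ord k)
        (ord.leadingCoeff q / ord.leadingCoeff (s.poly k)) * s.poly k)) := by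
  obtain ⟨hsig, hhom, -⟩ := H.normalForm hh
  obtain ⟨hpos, hN, -⟩ := H.Gg_mem hk
  refine H.setPoly hh.mem (hsig.sub_of_mem_below ?_) (hhom.sub ?_)
  · exact ((H.hasSig k hpos hN).monomial_mul _ (div_ne_zero (ord.leadingCoeff_ne_zero_iff.2 hq)
      (H.leadingCoeff_ne_zero hk))).mem_below (H.idx_le k hN) hlt
  · rw [← H.tsub_add_hm hh hq hred.1]
    exact H.homog_monomial_mul hk _ _

/-- The reductor's multiple has a greater signature than r_h, so subtracting q does not affect its
head, and its index can only be i. The new signature is not less than any in `done`, because S(r_h)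
is not. -/
theorem Inv.split (H : Inv ord f m D s) {h k : ℕ} {q : MvPolynomial (Fin n) K}
    (hh : s.Takes ord h q) (hq : q ≠ 0) (hk : k ∈ s.Gg) (hred : s.IsReductor ord h q k)
    (hnlt : ¬ Sig.Lt ord (Sig.mul (ord.degree q - s.hm ord k) (s.sig k)) (s.sig h)) :
    (s.sig k).idx = s.i ∧ Inv ord f m D
      { (s.setPoly h q).push
          ⟨Sig.mul (ord.degree q - s.hm ord k) (s.sig k),
            monomial (ord.degree q - s.hm ord k) (ord.leadingCoeff (s.poly k))⁻¹ * s.poly k -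
              C (ord.leadingCoeff q)⁻¹ * q⟩ with
        toDo := insert (s.N + 1) s.toDo } := by
  obtain ⟨hsig, hhom, -⟩ := H.normalForm hh
  obtain ⟨hpos, hN, hki, -⟩ := H.Gg_mem hk
  obtain ⟨-, hhN, hhi, -⟩ := H.toDo_mem h hh.mem
  have hlt := Sig.lt_of_not_lt hnlt hred.2.2.2
  have hidx : (s.sig k).idx = s.i := le_antisymm (hlt.idx_le.trans hhi.le) hki
  refine ⟨hidx, (H.setPoly hh.mem hsig hhom).push
    (r := ⟨Sig.mul (ord.degree q - s.hm ord k) (s.sig k), _⟩) hidx ?_ ?_ ?_⟩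
  · exact ((H.hasSig k hpos hN).monomial_mul _
      (inv_ne_zero (H.leadingCoeff_ne_zero hk))).sub_of_mem_below
      ((hsig.C_mul (inv_ne_zero (ord.leadingCoeff_ne_zero_iff.2 hq))).mem_below
        (H.idx_le h hhN) hlt)
  · change IsHomogeneous _ ((Sig.mul _ (s.sig k)).mon.degree + D (s.sig k).idx)
    rw [H.degree_mul_sig hk]
    refine (H.homog_monomial_mul hk _ _).sub ?_
    rw [H.tsub_add_hm hh hq hred.1]
    exact hhom.C_mul _
  · intro a ha h'
    rw [sig_setPoly] at h'
    exact H.not_lt a ha h hh.mem (hlt.trans h')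

/-- For g this is the failure of `IsReducible`, which admits reductors of smaller and of greater
signature and exempts only equality. For an older element a, the newcomer g imposes no condition: it
is not in G_i, and S(g) ≺ S(a) is excluded by `Inv.not_lt`. -/
theorem Inv.doneIrreducible_add (H : Inv ord f m D s) (hdone : DoneIrreducible ord s) {g : ℕ}
    {q : MvPolynomial (Fin n) K} (hg : s.AboutToAdd ord g q) :
    DoneIrreducible ord
      { s.setPoly g (C (ord.leadingCoeff q)⁻¹ * q) with
        toDo := s.toDo \ {g}
        done := insert g s.done } := by
  obtain ⟨hsig, hhom, hnf⟩ := H.normalForm hg.toTakes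
  obtain ⟨hmg, hgN, hgi, hgG, hgd⟩ := H.toDo_mem g hg.mem
  set s₁ := s.setPoly g (C (ord.leadingCoeff q)⁻¹ * q) with hs₁
  have F : Frame s s₁ := H.frame_setPoly hg.mem _
  have H₁ : Inv ord f m D s₁ := H.setPoly hg.mem
    (hsig.C_mul (inv_ne_zero (ord.leadingCoeff_ne_zero_iff.2 hg.ne_zero))) (hhom.C_mul _)
  have hhm : s₁.hm ord g = ord.degree q := by
    rw [hm, hs₁, poly_setPoly_self]
    have := degree_monomial_mul (ord := ord) (p := q) 0
      (inv_ne_zero (ord.leadingCoeff_ne_zero_iff.2 hg.ne_zero)) hg.ne_zero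
    rwa [zero_add] at this
  have h₁ := F.doneIrreducible H hdone
  intro a ha
  rcases ha with rfl | ha
  · constructor
    · intro b hb
      have hb' : b ∈ s.Gg := Or.inl (H.mem_G_i (Nat.le_succ _) hb)
      change ¬ s₁.hm ord b ≤ s₁.hm ord a
      rw [hhm, F.hm hb']
      exact hnf hg.ne_zero b hb
    · intro b hb hb' hi hle hF5 hrw
      change s₁.hm ord b ≤ s₁.hm ord a at hle
      change ¬ s₁.SatisfiesF5 ord (s₁.hm ord a - s₁.hm ord b) b at hF5
      change ¬ s₁.SatisfiesRewritten (s₁.hm ord a - s₁.hm ord b) b at hrw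
      change Sig.mul (s₁.hm ord a - s₁.hm ord b) (s₁.sig b) = s₁.sig a
      have hbG : b ∈ s.Gg := by
        rcases hb with hb | rfl | hb
        · exact Or.inl hb
        · exact hb'.elim (fun h => absurd h hgG) fun h => absurd h (Sig.Lt.irrefl _)
        · exact Or.inr hb
      have hbN := (H.Gg_mem hbG).2.1
      rw [hhm, F.hm hbG] at *
      rw [F.satisfiesF5_iff H hbG, not_satisfiesF5_iff] at hF5
      change (s₁.sig b).idx = s.i at hi
      rw [F.sig b hbN] at hi ⊢
      rw [F.sig a hgN]
      rw [hi] at hF5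
      by_contra hne
      exact hg.irreducible b hbG ⟨hle, hF5,
        fun h => hrw (F.satisfiesRewritten hbN ((H.isRewritten_iff hbN).1 h)), hne⟩
  · refine (h₁ a ha).imp_right fun h => ?_
    intro b hb hb' hi hle hF5 hrw
    have hne : b ≠ g := by
      rintro rfl
      rcases hb' with hb' | hb'
      · exact hgG hb'
      · exact H₁.not_lt a ha b hg.mem hb'
    exact h b (hb.imp_right fun h => h.resolve_left hne) hb' hi hle hF5 hrw

theorem step_inv (hf : ∀ i, 1 ≤ i → i ≤ m → f i ≠ 0) {s' : State n K} (H : Inv ord f m D s)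
    (hpl : PlaceInv ord D s) (hstep : Step ord s s') :
    Inv ord f m D s' ∧ PlaceInv ord D s' := by
  cases hstep with
  | call s₁ j hplace hj hi hs' =>
    simp only [PlaceInv, hplace] at hpl
    obtain ⟨hP, hPd, htoDo, hdone⟩ := hpl
    refine ⟨H.call hf hj hi hP hPd htoDo hdone hs', ?_⟩
    subst hs'
    exact ⟨hPd, htoDo, hdone⟩
  | ret hplace hP =>
    simp only [PlaceInv, hplace] at hpl
    exact ⟨H.relocate _ rfl rfl rfl, hP, hpl⟩
  | select d hplace hd hmin =>
    simp only [PlaceInv, hplace] at hpl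
    obtain ⟨hPd, htoDo, hdone⟩ := hpl
    refine ⟨H.relocate _ ?_ htoDo rfl, hdone, d, ?_⟩
    · rw [hPd, Set.union_empty]
      ext p
      simp only [Set.mem_union, Set.mem_ofPred_eq]
      tauto
    · refine ⟨fun p hp => lt_of_le_of_ne (hmin p hp.1) hp.2.symm, fun p hp => hp.2,
        fun k hk => absurd hk (Set.notMem_empty k), fun k hk => ?_⟩
      change k ∈ s.done at hk
      rw [hdone] at hk
      exact absurd hk (Set.notMem_empty k)
  | spolSkip p hplace hp hrw =>
    rw [placeInv_spol hplace] at hpl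
    obtain ⟨hdone, d, hd⟩ := hpl
    have hpair := H.isPair p (Or.inr hp)
    rw [H.isRewritten_iff (H.G_mem _ hpair.mem₁).2.1,
      H.isRewritten_iff (H.G_mem _ hpair.mem₂).2.1] at hrw
    refine ⟨H.erase_pair hrw, ?_⟩
    rw [placeInv_spol (by exact hplace)]
    exact ⟨hdone, d, hd.of_eq le_rfl Set.sdiff_subset rfl fun k hk => Or.inl ⟨hk, rfl⟩⟩
  | spolAdd p hplace hp h₁ h₂ =>
    rw [placeInv_spol hplace] at hpl
    obtain ⟨hdone, d, hd⟩ := hpl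
    have hpair := H.isPair p (Or.inr hp)
    rw [H.isRewritten_iff (H.G_mem _ hpair.mem₁).2.1] at h₁
    rw [H.isRewritten_iff (H.G_mem _ hpair.mem₂).2.1] at h₂
    refine ⟨H.spolAdd hpair h₁ h₂ hdone, ?_⟩
    rw [placeInv_spol (by exact hplace)]
    refine ⟨hdone, d, hd.of_eq le_rfl Set.sdiff_subset rfl ?_⟩
    rintro k ((rfl | hk) | hk)
    · right
      change ((s.push _).sig (s.N + 1)).mon.degree + D s.i = d
      rw [sig_push_self, ← hpair.idx, H.degree_mul_sig (Or.inl hpair.mem₁), hpair.u₁_add]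
      exact hd.Pd p hp
    · exact Or.inl ⟨Or.inl hk, sig_push_of_le _ (H.toDo_mem k hk).2.1⟩
    · exact Or.inl ⟨Or.inr hk, sig_push_of_le _ (H.done_mem k hk).2.1⟩
  | startReduction hplace hPd =>
    rw [placeInv_spol hplace] at hpl
    obtain ⟨hdone, d, hd⟩ := hpl
    refine ⟨H.relocate _ rfl rfl hdone, hPd, ⟨d, ?_⟩, fun a ha => absurd ha (Set.notMem_empty a)⟩
    exact hd.of_eq le_rfl le_rfl rfl fun k hk =>
      Or.inl ⟨hk.imp_right fun h => absurd h (Set.notMem_empty k), rfl⟩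
  | zero h hh =>
    rw [placeInv_reduction hh.place] at hpl
    obtain ⟨hPd, ⟨d, hd⟩, hdone⟩ := hpl
    obtain ⟨hsig, hhom, -⟩ := H.normalForm hh
    refine ⟨(H.setPoly hh.mem hsig hhom).drop_toDo (poly_setPoly_self h 0), ?_⟩
    rw [placeInv_reduction (by exact hh.place)]
    refine ⟨hPd, ⟨d, hd.of_eq le_rfl le_rfl rfl fun k hk => Or.inl
      ⟨hk.imp_left fun h => h.1, sig_setPoly _ _ k⟩⟩, ?_⟩
    exact (H.frame_setPoly hh.mem 0).doneIrreducible H hdone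
  | add g q hg =>
    rw [placeInv_reduction hg.place] at hpl
    obtain ⟨hPd, ⟨d, hd⟩, hdone⟩ := hpl
    obtain ⟨hsig, hhom, -⟩ := H.normalForm hg.toTakes
    have hc := inv_ne_zero (ord.leadingCoeff_ne_zero_iff.2 hg.ne_zero)
    have H₁ := H.setPoly hg.mem (hsig.C_mul hc) (hhom.C_mul _)
    constructor
    · refine H₁.finish_toDo (h := g) hg.mem ?_ fun k hk => ?_
      · rw [poly_setPoly_self]
        exact mul_ne_zero (by simpa using hc) hg.ne_zero
      · rw [sig_setPoly, sig_setPoly]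
        exact hg.min k hk
    · rw [placeInv_reduction (by exact hg.place)]
      refine ⟨hPd, ⟨d, hd.of_eq le_rfl le_rfl rfl fun k hk => Or.inl ⟨?_, sig_setPoly _ _ k⟩⟩,
        H.doneIrreducible_add hdone hg⟩
      rcases hk with hk | rfl | hk
      · exact Or.inl hk.1
      · exact Or.inl hg.mem
      · exact Or.inr hk
  | reduce h q k hh hq hk hred hlt =>
    rw [placeInv_reduction hh.place] at hpl
    obtain ⟨hPd, ⟨d, hd⟩, hdone⟩ := hpl
    refine ⟨H.reduce hh hq hk hred hlt, ?_⟩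
    rw [placeInv_reduction (by exact hh.place)]
    exact ⟨hPd, ⟨d, hd.of_eq le_rfl le_rfl rfl fun k hk => Or.inl ⟨hk, sig_setPoly _ _ k⟩⟩,
      (H.frame_setPoly hh.mem _).doneIrreducible H hdone⟩
  | split h q k hh hq hk hred hnlt =>
    rw [placeInv_reduction hh.place] at hpl
    obtain ⟨hPd, ⟨d, hd⟩, hdone⟩ := hpl
    obtain ⟨hsig, hhom, -⟩ := H.normalForm hh
    obtain ⟨hidx, H'⟩ := H.split hh hq hk hred hnlt
    refine ⟨H', ?_⟩
    rw [placeInv_reduction (by exact hh.place)]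
    have H₁ := H.setPoly hh.mem hsig hhom
    refine ⟨hPd, ⟨d, hd.of_eq le_rfl le_rfl rfl ?_⟩, (H₁.frame_push _ _).doneIrreducible H₁
      ((H.frame_setPoly hh.mem q).doneIrreducible H hdone)⟩
    have hold : ∀ r : LabeledPoly n K, ∀ k ≤ s.N,
        ((s.setPoly h q).push r).sig k = s.sig k := fun r k hk =>
      (sig_push_of_le (s := s.setPoly h q) r hk).trans (sig_setPoly h q k)
    rintro k' ((rfl | hk') | hk')
    · right
      change (((s.setPoly h q).push _).sig ((s.setPoly h q).N + 1)).mon.degree + D s.i = d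
      rw [sig_push_self, ← hidx, H.degree_mul_sig hk, H.tsub_add_hm hh hq hred.1,
        (H.toDo_mem h hh.mem).2.2.1]
      exact hd.toDo h hh.mem
    · exact Or.inl ⟨Or.inl hk', hold _ k' (H.toDo_mem k' hk').2.1⟩
    · exact Or.inl ⟨Or.inr hk', hold _ k' (H.done_mem k' hk').2.1⟩
  | endReduction hplace htoDo =>
    rw [placeInv_reduction hplace] at hpl
    exact ⟨H.relocate _ rfl rfl rfl, hpl.1, htoDo⟩
  | move r hplace hr =>
    simp only [PlaceInv, hplace] at hpl
    refine ⟨H.move hpl.2 hr, ?_⟩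
    simp only [PlaceInv, hplace]
    exact hpl
  | again hplace hdone =>
    simp only [PlaceInv, hplace] at hpl
    exact ⟨H.relocate _ rfl rfl rfl, hpl.1, hpl.2, hdone⟩

theorem inv_of_reachable (hm : 1 ≤ m)
    (hf : ∀ i, 1 ≤ i → i ≤ m → f i ≠ 0 ∧ (f i).IsHomogeneous (D i)) (hs : Reachable ord f m s) :
    Inv ord f m D s ∧ PlaceInv ord D s := by
  induction hs with
  | refl => exact ⟨inv_init hm hf, rfl, rfl, rfl, rfl⟩
  | tail _ hstep ih => exact step_inv (fun i h1 h2 => (hf i h1 h2).1) ih.1 ih.2 hstep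

/-- Without input the index is 0 and no call can start. This disposes of `m = 0` in the main
theorem. -/
theorem eq_init_of_reachable (hs : Reachable ord f 0 s) : s = init f 0 := by
  rcases Relation.ReflTransGen.cases_head hs with h | ⟨s', h, -⟩
  · exact h.symm
  · have hplace : (init f 0).place = Place.between := rfl
    generalize hs0 : init f 0 = s0 at h hplace
    exfalso
    cases h with
    | call s₁ j hplace' hj hi =>
      subst hs0
      exact absurd hi (Nat.succ_ne_zero j).symm
    | zero h hh => exact absurd (hplace.symm.trans hh.place) (by simp)
    | add g q hg => exact absurd (hplace.symm.trans hg.place) (by simp)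
    | reduce h q k hh => exact absurd (hplace.symm.trans hh.place) (by simp)
    | split h q k hh => exact absurd (hplace.symm.trans hh.place) (by simp)
    | _ => simp_all

end Step

/-! ### Representations -/

section Representation

variable {n : ℕ} {K : Type*} [Field K] {ord : MonomialOrder (Fin n)}
  {f : ℕ → MvPolynomial (Fin n) K} {m : ℕ} {D : ℕ → ℕ} {s : State n K}

/-- An element b of index greater than i would lie in G_{i+1}, whose head monomials do not divide
that of r_a. So b has index i and `DoneIrreducible` applies. -/
theorem Inv.done_not_reducible (H : Inv ord f m D s) (hdone : DoneIrreducible ord s) {a b : ℕ}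
    (ha : a ∈ s.done) (hb : b ∈ s.Gg) (hb' : b ∈ s.G s.i ∨ Sig.Lt ord (s.sig b) (s.sig a))
    {u : Mon n} (hu : u + s.hm ord b = s.hm ord a) (hF5 : ¬ s.SatisfiesF5 ord u b)
    (hrw : ¬ s.SatisfiesRewritten u b) : Sig.mul u (s.sig b) = s.sig a := by
  obtain rfl : u = s.hm ord a - s.hm ord b := by rw [← hu, add_tsub_cancel_right]
  have hle : s.hm ord b ≤ s.hm ord a := hu ▸ le_add_self
  obtain ⟨h1, h2⟩ := hdone a ha
  obtain ⟨-, -, hi, -⟩ := H.Gg_mem hb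
  refine h2 b hb hb' (hi.antisymm ?_).symm hle hF5 hrw
  by_contra hlt
  refine h1 b ?_ hle
  rw [H.G_eq _ (Nat.le_succ _)]
  rcases hb with hb | hb
  · exact ⟨hb, by omega⟩
  · exact absurd (H.done_mem b hb).2.2.1.le hlt

/-- The terms `u r_a` and `v r_b` with equal head monomials and different signatures less than
`S(g)` cannot both pass the two criteria. -/
theorem Inv.no_collision (H : Inv ord f m D s) (hord : Graded ord)
    (hplace : s.place = Place.reduction) (hpl : PlaceInv ord D s) {g : ℕ} (hg : g ∈ s.toDo)
    {a b : ℕ} (ha : a ∈ s.Gg) (hb : b ∈ s.Gg) {u v : Mon n}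
    (huv : u + s.hm ord a = v + s.hm ord b)
    (hlt : Sig.Lt ord (Sig.mul v (s.sig b)) (Sig.mul u (s.sig a)))
    (hltg : Sig.Lt ord (Sig.mul u (s.sig a)) (s.sig g))
    (hF5a : ¬ s.SatisfiesF5 ord u a) (hrwa : ¬ s.SatisfiesRewritten u a)
    (hF5b : ¬ s.SatisfiesF5 ord v b) (hrwb : ¬ s.SatisfiesRewritten v b) : False := by
  rw [placeInv_reduction hplace] at hpl
  obtain ⟨hPd, ⟨d, hd⟩, hdone⟩ := hpl
  have hgi := (H.toDo_mem g hg).2.2.1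
  have hsum₁ := mkPair_u₁_add (ord := ord) (s := s) a b
  have hsum₂ := mkPair_u₂_add (ord := ord) (s := s) a b
  have ht : (s.mkPair ord a b).t ≤ u + s.hm ord a :=
    sup_le le_add_self (huv ▸ le_add_self)
  -- Both multiples are w times the parts of the S-pair. As the criteria are inherited by multiples,
  -- the S-pair itself passes them.
  obtain ⟨w, hw⟩ := exists_add_of_le ht
  have hu : u = w + (s.mkPair ord a b).u₁ := by
    have : u + s.hm ord a = w + (s.mkPair ord a b).u₁ + s.hm ord a := by
      rw [hw, ← hsum₁]
      abel
    exact add_right_cancel this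
  have hv : v = w + (s.mkPair ord a b).u₂ := by
    have : v + s.hm ord b = w + (s.mkPair ord a b).u₂ + s.hm ord b := by
      rw [← huv, hw, ← hsum₂]
      abel
    exact add_right_cancel this
  have hule : (s.mkPair ord a b).u₁ ≤ u := hu ▸ le_add_self
  have hvle : (s.mkPair ord a b).u₂ ≤ v := hv ▸ le_add_self
  have hab : Needed ord s a b := by
    refine ⟨?_, mt (SatisfiesF5.mono · hule) hF5a, mt (SatisfiesF5.mono · hvle) hF5b,
      mt (SatisfiesRewritten.mono · hule) hrwa, mt (SatisfiesRewritten.mono · hvle) hrwb⟩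
    rw [hu, hv, ← Sig.mul_mul, ← Sig.mul_mul, Sig.lt_mul_iff] at hlt
    exact hlt
  -- The signature of the first part is below S(g) with the same index, so its degree is bounded by
  -- that of g.
  have hdeg : (s.sig a).idx = s.i → (s.mkPair ord a b).t.degree ≤ d := by
    intro hi
    have h1 := ((Sig.dvd_mul_of_le hule (s.sig a)).le.trans_lt hltg).degree_le hord
      (hi.trans hgi.symm)
    have h2 := H.degree_mul_sig ha (s.mkPair ord a b).u₁
    have h3 := hd.toDo g hg
    rw [hsum₁, hi] at h2
    omega
  have hdone_deg : ∀ c ∈ s.done, (s.hm ord c).degree = d := by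
    intro c hc
    rw [H.degree_hm (Or.inr hc), (H.done_mem c hc).2.2.1]
    exact hd.done c hc
  -- Elements of `done` already have degree d, which leaves no room for a nontrivial cofactor.
  have hzero : ∀ c ∈ s.done, ∀ x : Mon n, x + s.hm ord c = (s.mkPair ord a b).t →
      (s.sig a).idx = s.i → x = 0 := by
    intro c hc x hx hi
    have h1 := congrArg Finsupp.degree hx
    have h2 := hdeg hi
    have h3 := hdone_deg c hc
    rw [map_add] at h1
    exact (Finsupp.degree_eq_zero_iff x).1 (by omega)
  have hfin := hab.lt
  by_cases had : a ∈ s.done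
  · have h0 := hzero a had _ hsum₁ (H.done_mem a had).2.2.1
    rw [h0, zero_add, ← hsum₂] at hsum₁
    rw [h0, Sig.zero_mul] at hfin
    -- The top-reductor r_b was available when r_a was added, since S(r_b) ≺ S(r_a).
    exact hfin.ne (H.done_not_reducible hdone had hb
      (Or.inr ((Sig.le_mul_self _ _).trans_lt hfin)) hsum₁.symm hab.f5₂ hab.rw₂)
  · have haG : a ∈ s.G s.i := ha.resolve_right had
    by_cases hbd : b ∈ s.done
    · have hi : (s.sig a).idx = s.i :=
        le_antisymm (hfin.idx_le.trans (H.done_mem b hbd).2.2.1.le) (H.Gg_mem ha).2.2.1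
      have h0 := hzero b hbd _ hsum₂ hi
      rw [h0, zero_add, ← hsum₁] at hsum₂
      rw [h0, Sig.zero_mul] at hfin
      -- Here the reducing multiple has the greater signature, and r_a was available as an element
      -- of G_i.
      exact hfin.ne (H.done_not_reducible hdone hbd ha (Or.inl haG) hsum₂.symm
        hab.f5₁ hab.rw₁).symm
    · obtain ⟨hi, hmem⟩ := H.complete a haG b (hb.resolve_right hbd) hab
      rw [hPd, Set.union_empty] at hmem
      exact absurd (hd.P _ hmem) (hdeg hi).not_gt

/-- A representation whose elements pass both criteria, with head monomials bounded by that of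
the represented polynomial. -/
structure GoodRepr (ord : MonomialOrder (Fin n)) (s : State n K) (p : MvPolynomial (Fin n) K)
    (ρ : (Mon n × ℕ) →₀ K) : Prop where
  repr : s.IsRepr p ρ
  f5 : ∀ x ∈ ρ.support, ¬ s.SatisfiesF5 ord x.1 x.2
  rw : ∀ x ∈ ρ.support, ¬ s.SatisfiesRewritten x.1 x.2
  hm_le : ∀ x ∈ ρ.support, ord.toSyn (x.1 + s.hm ord x.2) ≤ ord.toSyn (ord.degree p)

theorem goodRepr_zero : GoodRepr ord s (0 : MvPolynomial (Fin n) K) 0 :=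
  ⟨⟨by simp, by simp⟩, by simp, by simp, by simp⟩

/-- Otherwise every summand has a smaller head monomial, and the coefficient of p at its head
monomial vanishes. -/
theorem Inv.exists_hm_eq_degree (H : Inv ord f m D s) {p : MvPolynomial (Fin n) K}
    {ρ : (Mon n × ℕ) →₀ K} (hρ : GoodRepr ord s p ρ) (hp : p ≠ 0) :
    ∃ x ∈ ρ.support, x.1 + s.hm ord x.2 = ord.degree p := by
  by_contra! hne
  refine ord.coeff_degree_ne_zero_iff.2 hp ?_
  rw [congrArg (coeff (ord.degree p)) hρ.repr.2, Finsupp.sum, coeff_sum]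
  refine Finset.sum_eq_zero fun x hx => ord.coeff_eq_zero_of_lt ?_
  rw [degree_monomial_mul x.1 (Finsupp.mem_support_iff.1 hx) (H.Gg_mem (hρ.repr.1 x hx)).2.2.2]
  exact lt_of_le_of_ne (hρ.hm_le x hx) fun h => hne x hx (ord.toSyn.injective h)

/-- The pair (t, k) may already occur in ρ: the conditions only concern pairs in the support, and
the support of a sum lies in the union. -/
theorem GoodRepr.add_single {p : MvPolynomial (Fin n) K} {ρ : (Mon n × ℕ) →₀ K} {t : Mon n}
    {k : ℕ} {c : K} (hρ : GoodRepr ord s (p - monomial t c * s.poly k) ρ) (hk : k ∈ s.Gg)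
    (hF5 : ¬ s.SatisfiesF5 ord t k) (hrw : ¬ s.SatisfiesRewritten t k)
    (hle : ord.toSyn (t + s.hm ord k) ≤ ord.toSyn (ord.degree p)) :
    GoodRepr ord s p (Finsupp.single (t, k) c + ρ) := by
  classical
  have hsupp : ∀ x ∈ (Finsupp.single (t, k) c + ρ).support, x = (t, k) ∨ x ∈ ρ.support := by
    intro x hx
    rcases Finset.mem_union.1 (Finsupp.support_add hx) with h | h
    · exact Or.inl (Finset.mem_singleton.1 (Finsupp.support_single_subset h))
    · exact Or.inr h
  have hdeg : ord.toSyn (ord.degree (p - monomial t c * s.poly k)) ≤ ord.toSyn (ord.degree p) := by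
    refine ord.degree_sub_le.trans (sup_le le_rfl (le_trans ?_ hle))
    refine ord.degree_mul_le.trans ?_
    rw [map_add, map_add]
    exact add_le_add_left (ord.degree_monomial_le c) _
  refine ⟨⟨fun x hx => ?_, ?_⟩, fun x hx => ?_, fun x hx => ?_, fun x hx => ?_⟩
  · rcases hsupp x hx with rfl | h
    · exact hk
    · exact hρ.repr.1 x h
  · rw [Finsupp.sum_add_index' (by simp) (by simp [add_mul]), ← hρ.repr.2,
      Finsupp.sum_single_index (by simp)]
    ring
  · rcases hsupp x hx with rfl | h
    · exact hF5
    · exact hρ.f5 x h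
  · rcases hsupp x hx with rfl | h
    · exact hrw
    · exact hρ.rw x h
  · rcases hsupp x hx with rfl | h
    · exact hle
    · exact (hρ.hm_le x h).trans hdeg

/-- Every signature either belongs to a syzygy or is the signature of a multiple of an element
of `G_i ∪ Done` that passes both criteria. -/
theorem Inv.exists_generator (H : Inv ord f m D s) {g : ℕ}
    (hmin : ∀ k ∈ s.toDo, ¬ Sig.Lt ord (s.sig k) (s.sig g)) {σ : Sig n} (him : σ.idx ≤ m)
    (hi : s.i ≤ σ.idx) (hlt : Sig.Lt ord σ (s.sig g)) (hσ : gen f σ ∉ below ord f m σ) :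
    ∃ t, ∃ k ∈ s.Gg, Sig.mul t (s.sig k) = σ ∧ ¬ s.SatisfiesF5 ord t k ∧
      ¬ s.SatisfiesRewritten t k := by
  classical
  have h1 := H.one_le_i
  have hmN := H.m_le
  have hdvd₀ : Sig.Dvd (s.sig σ.idx) σ := by
    rw [H.sig_input _ him]
    exact ⟨rfl, bot_le⟩
  have hidxN : σ.idx ≤ s.N := him.trans hmN
  -- The input polynomial with the index of σ is always a candidate, so a last one exists and is
  -- positive.
  obtain ⟨k, hpos, hkN, hdvd, hlast⟩ : ∃ k, 1 ≤ k ∧ k ≤ s.N ∧ Sig.Dvd (s.sig k) σ ∧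
      ∀ j, k < j → j ≤ s.N → ¬ Sig.Dvd (s.sig j) σ := by
    refine ⟨Nat.findGreatest (fun k => Sig.Dvd (s.sig k) σ) s.N, ?_, Nat.findGreatest_le _,
      Nat.findGreatest_spec (P := fun k => Sig.Dvd (s.sig k) σ) hidxN hdvd₀,
      fun j h2 h3 => Nat.findGreatest_is_greatest h2 h3⟩
    exact (h1.trans hi).trans (Nat.le_findGreatest hidxN hdvd₀)
  obtain ⟨t, ht⟩ := hdvd.exists_mul
  have hne : s.poly k ≠ 0 := by
    intro h0
    have hk := H.hasSig k hpos hkN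
    rw [h0] at hk
    have := monomial_mul_mem_below t 1 (gen_mem_below_of_hasSig_zero hk)
    rw [monomial_mul_gen, one_smul, ht] at this
    exact hσ this
  have hkG : k ∈ s.Gg := by
    rcases H.covered k hpos hkN (hdvd.1 ▸ hi) with h | h | h | h
    · exact Or.inl h
    · exact Or.inr h
    · exact absurd (hdvd.le.trans_lt hlt) (hmin k h)
    · exact absurd h hne
  refine ⟨t, k, hkG, ht, ?_, ?_⟩
  · have hmon : t + (s.sig k).mon = σ.mon := congrArg Sig.mon ht
    rw [not_satisfiesF5_iff, hdvd.1, hmon, phiFixes_iff]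
    -- A head monomial of G_{idx+1} dividing the monomial of σ gives a principal syzygy with head σ.
    intro b hb hb0 hle
    have hb1 := H.Gg_mem (Or.inl (H.mem_G_i (by omega) hb))
    have hbi := H.le_idx_of_mem_G (by omega) hb
    exact hσ (gen_mem_below_of_mem_beyond him
      ((H.hasSig b hb1.1 hb1.2.1).mem_beyond (H.idx_le b hb1.2.1) hbi) hb0 hle)
  · rintro ⟨j, hkj, hj, hjd⟩
    exact hlast j hkj hj (ht ▸ hjd)

/-- The polynomial p need not come from the list and c may be 0; this generality lets the induction
apply to the remainder. -/
theorem Inv.exists_goodRepr (H : Inv ord f m D s) (hord : Graded ord)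
    (hplace : s.place = Place.reduction) (hpl : PlaceInv ord D s) {g : ℕ} (hg : g ∈ s.toDo)
    (hmin : ∀ k ∈ s.toDo, ¬ Sig.Lt ord (s.sig k) (s.sig g)) (σ : Sig n) :
    σ.idx ≤ m → s.i ≤ σ.idx → Sig.Lt ord σ (s.sig g) →
    ∀ (p : MvPolynomial (Fin n) K) (c : K), p - c • gen f σ ∈ below ord f m σ →
      ∃ ρ, GoodRepr ord s p ρ ∧ s.SignatureSafe ord σ ρ := by
  induction σ using (Sig.wellFounded_lt ord m).induction with
  | _ σ ih =>
    intro him hi hlt p c hp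
    have hbelow : ∀ p' ∈ below ord f m σ, ∃ ρ, GoodRepr ord s p' ρ ∧
        ∀ x ∈ ρ.support, Sig.Lt ord (Sig.mul x.1 (s.sig x.2)) σ := by
      intro p' hp'
      rcases exists_sub_smul_gen_mem_below hp' with rfl | ⟨τ, hτm, hτ, c', hc'⟩
      · exact ⟨0, goodRepr_zero, by simp⟩
      · obtain ⟨ρ, h1, h2⟩ := ih τ ⟨hτm, hτ⟩ hτm (hi.trans hτ.idx_le) (hτ.trans hlt) p' c' hc'
        exact ⟨ρ, h1, fun x hx => (h2 x hx).trans_lt hτ⟩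
    have hclose : p ∈ below ord f m σ → ∃ ρ, GoodRepr ord s p ρ ∧ s.SignatureSafe ord σ ρ := by
      intro h
      obtain ⟨ρ, h1, h2⟩ := hbelow p h
      exact ⟨ρ, h1, fun x hx => Or.inl (h2 x hx)⟩
    by_cases hσ : gen f σ ∈ below ord f m σ
    · refine hclose ?_
      rw [← sub_add_cancel p (c • gen f σ)]
      exact add_mem hp (Submodule.smul_mem _ _ hσ)
    by_cases hc : c = 0
    · refine hclose ?_
      rwa [hc, zero_smul, sub_zero] at hp
    by_cases hp0 : p = 0
    · exact ⟨0, hp0 ▸ goodRepr_zero, fun x hx => absurd hx (by simp)⟩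
    obtain ⟨t, k, hk, rfl, hF5, hrw⟩ := H.exists_generator hmin him hi hlt hσ
    obtain ⟨hpos, hkN, -, hk0⟩ := H.Gg_mem hk
    obtain ⟨e, he, hmem⟩ := (H.hasSig k hpos hkN).monomial_mul t (one_ne_zero (α := K))
    -- e is the coefficient of `gen f σ` in t r_k, so c / e cancels the σ-parts.
    have ha : c / e ≠ 0 := div_ne_zero hc he
    have hterm : monomial t (c / e) * s.poly k = (c / e) • (monomial t 1 * s.poly k) := by
      rw [← smul_mul_assoc, smul_monomial, smul_eq_mul, mul_one]
    have hrest : p - monomial t (c / e) * s.poly k ∈ below ord f m (Sig.mul t (s.sig k)) := by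
      have := sub_mem hp (Submodule.smul_mem _ (c / e) hmem)
      rwa [smul_sub, smul_smul, div_mul_cancel₀ _ he, ← hterm, sub_sub_sub_cancel_right] at this
    obtain ⟨ρ, hρ, hρlt⟩ := hbelow _ hrest
    have hdeg := degree_monomial_mul (ord := ord) t ha hk0
    by_cases hle : ord.toSyn (t + s.hm ord k) ≤ ord.toSyn (ord.degree p)
    · refine ⟨_, hρ.add_single hk hF5 hrw hle, fun x hx => ?_⟩
      classical
      rcases Finset.mem_union.1 (Finsupp.support_add hx) with h | h
      · rw [Finset.mem_singleton.1 (Finsupp.support_single_subset h)]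
        exact Or.inr rfl
      · exact Or.inl (hρlt x h)
    · exfalso
      -- The remainder now has the head monomial of t r_k, so some term of its representation
      -- collides with t r_k.
      rw [not_le, hm, ← hdeg] at hle
      have hdeg' : ord.degree (p - monomial t (c / e) * s.poly k) = t + s.hm ord k := by
        rw [← neg_sub, ord.degree_neg, ord.degree_sub_of_lt hle, hdeg, hm]
      have hne : p - monomial t (c / e) * s.poly k ≠ 0 := by
        intro h
        rw [sub_eq_zero.1 h] at hle
        exact lt_irrefl _ hle
      obtain ⟨x, hx, hxdeg⟩ := H.exists_hm_eq_degree hρ hne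
      exact H.no_collision hord hplace hpl hg hk (hρ.repr.1 x hx)
        (hdeg'.symm.trans hxdeg.symm) (hρlt x hx) hlt hF5 hrw (hρ.f5 x hx) (hρ.rw x hx)

end Representation

end State

end F5

theorem mainTheorem4 {K : Type*} [Field K] {n : ℕ} (ord : MonomialOrder (Fin n))
    (hord : F5.Graded ord) (m : ℕ) (f : ℕ → MvPolynomial (Fin n) K)
    (hf : ∀ i, 1 ≤ i → i ≤ m → f i ≠ 0 ∧ ∃ d, (f i).IsHomogeneous d)
    (s : F5.State n K) (hs : F5.Reachable ord f m s) (hi : s.i = 1)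
    (g : ℕ) (q : MvPolynomial (Fin n) K) (hg : s.AboutToAdd ord g q)
    (c : K) (t : F5.Mon n) (h : ℕ) (hh : h ∈ s.Gg)
    (hlt : F5.Sig.Lt ord (F5.Sig.mul t (s.sig h)) (s.sig g)) :
    ∃ ρ : (F5.Mon n × ℕ) →₀ K,
      s.IsRepr (MvPolynomial.monomial t c * s.poly h) ρ ∧
      s.SignatureSafe ord (F5.Sig.mul t (s.sig h)) ρ ∧
      ∀ x ∈ ρ.support,
        ¬ s.SatisfiesF5 ord x.1 x.2 ∧
        ¬ s.SatisfiesRewritten x.1 x.2 ∧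
        ord.toSyn (ord.degree (MvPolynomial.monomial x.1 (ρ x) * s.poly x.2)) ≤
          ord.toSyn (ord.degree (MvPolynomial.monomial t c * s.poly h)) := by
  -- Outside 1, …, m the degree is a dummy value.
  choose D hD using fun i : ℕ => show ∃ d, 1 ≤ i → i ≤ m → (f i).IsHomogeneous d by
    by_cases h : 1 ≤ i ∧ i ≤ m
    · obtain ⟨-, d, hd⟩ := hf i h.1 h.2
      exact ⟨d, fun _ _ => hd⟩
    · exact ⟨0, fun h1 h2 => absurd ⟨h1, h2⟩ h⟩
  have hm : 1 ≤ m := by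
    rcases Nat.eq_zero_or_pos m with rfl | hm
    · rw [F5.State.eq_init_of_reachable hs] at hi
      exact absurd hi Nat.zero_ne_one
    · exact hm
  obtain ⟨H, hpl⟩ := F5.State.inv_of_reachable hm
    (fun i h1 h2 => ⟨(hf i h1 h2).1, hD i h1 h2⟩) hs
  obtain ⟨hpos, hN, hidx, -⟩ := H.Gg_mem hh
  obtain ⟨a, ha⟩ : ∃ a : K, MvPolynomial.monomial t c * s.poly h - a • F5.gen f
      (F5.Sig.mul t (s.sig h)) ∈ F5.below ord f m (F5.Sig.mul t (s.sig h)) := by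
    by_cases hc : c = 0
    · exact ⟨0, by simp [hc]⟩
    · obtain ⟨a, -, ha⟩ := (H.hasSig h hpos hN).monomial_mul t hc
      exact ⟨a, ha⟩
  obtain ⟨ρ, hρ, hsafe⟩ := H.exists_goodRepr hord hg.place hpl hg.mem hg.min
    (F5.Sig.mul t (s.sig h)) (H.idx_le h hN) hidx hlt _ a ha
  refine ⟨ρ, hρ.repr, hsafe, fun x hx => ⟨hρ.f5 x hx, hρ.rw x hx, ?_⟩⟩
  rw [F5.degree_monomial_mul x.1 (Finsupp.mem_support_iff.1 hx)
    (H.Gg_mem (hρ.repr.1 x hx)).2.2.2]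
  exact hρ.hm_le x hx
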